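/- Let $(E,\|\cdot\|)$ be a normed space, $s>0$, $\lambda>0$, $K\ge 1$. Let $\mathbb D([0,1[,E)$ be the set of piecewise constant functions $f:[0,1[\to E$ with finitely many jumps, taking the new value at each jump time, with the $\sigma$-field generated by the evaluations, and set $$\rho_{\mathbb D}(f,g)=\int_0^1\|f(t)-g(t)\|\,dt .$$ For a random variable $X$, a distortion $\rho$ and $r\ge 0$ let $$D^{(q)}(r\,|\,X,\rho,s)=\inf\Big\{\big(\mathbb E\min_{a\in\mathcal C}\rho(X,a)^s\big)^{1/s}:\ \mathcal C\ne\emptyset \text{ finite},\ \log\#\mathcal C\le r\Big\},$$ $$D^{(e)}(r\,|\,X,\rho,s)=\inf\Big\{\big(\mathbb E\rho(X,\hat X)^s\big)^{1/s}:\ \hat X\text{ a random variable with } H(\hat X)\le r\Big\},$$ where $H$ is the discrete entropy in nats ($H=\infty$ for non-discrete random variables), and for $\varepsilon>0$ $$d^{(q)}(\varepsilon\,|\,X,\rho,s)=\inf\{n\in\mathbb N,\ n\ge1:\ D^{(q)}(\log n\,|\,X,\rho,s)\le\varepsilon\}\in\mathbb N\cup\{\infty\}.$$ Let $X$ be a $\mathbb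 D([0,1[,E)$-valued random variable with $N_X$ jumps, at the positions $0<Y_1<\dots<Y_{N_X}<1$; put $Y_0=0$ and $Z^{(i)}=X(Y_i)-X(Y_{i-1})$ for $1\le i\le N_X$. Assume: 1. $\mathbb P(N_X=k)\le K e^{-\lambda}\lambda^k/k!$ for all $k\ge0$; 2. $X(0)=x_0$ almost surely for some $x_0\in E$; 3. for every $k$ with $\mathbb P(N_X=k)>0$, conditionally on $\{N_X=k\}$, the vector $(Y_1,\dots,Y_k)$ is independent of $(X(Y_0),\dots,X(Y_k))$; 4. there is an $E$-valued random variable $\zeta$ such that for every $k$ with $\mathbb P(N_X=k)>0$ and every $1\le i\le k$, conditionally on $\{N_X=k\}$, the increment $Z^{(i)}$ has the law of $\zeta$ (the increments need not be independent of each other). Then the following hold. (a) If $$\gamma:=\limsup_{\varepsilon\downarrow0}\frac{\log d^{(q)}(\varepsilon\,|\,\zeta,\|\cdot\|,s)}{\log(1/\varepsilon)}\in[0,\infty[,$$ then $$\liminf_{r\to\infty}\ \frac{-\log D^{(q)}(r\,|\,X,\rho_{\mathbb D},s)}{\sqrt{\frac{2}{s(1+\gamma)}\,r\log r}}\ \ge\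 1 ,$$ where $-\log 0=\infty$. (b) If $d^{(q)}(\varepsilon\,|\,\zeta,\|\cdot\|,s)<\infty$ for all $\varepsilon>0$, then for all $r\ge0$ $$D^{(e)}\Big(K\big(\lambda r+\lambda\log d^{(q)}(e^{-r}\,|\,\zeta,\|\cdot\|,s)\big)\,\Big|\,X,\rho_{\mathbb D},s\Big)\le C\,e^{-r},$$ where the constant $C>0$ depends only on $s$, $K$, $\lambda$ and $\mathbb E\|\zeta\|^s$. -/

import Mathlib

open MeasureTheory ProbabilityTheory Filter Topology
open scoped ENNReal

noncomputable section

/-! ### Coding quantities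

A distortion is written as a function with values in `[0, ∞]`; the two distortions used below
(`normDist` and `pathDist normDist`) only take finite values.  Expectations of nonnegative
quantities are Lebesgue integrals with values in `[0, ∞]`, so nothing is lost when a moment is
infinite. -/

/-- The quantization error: the infimum of `(𝔼 min_{a ∈ 𝒞} ρ(X,a)^s)^{1/s}` over all (finite,
nonempty) codebooks `𝒞` with `log #𝒞 ≤ r`. -/
def quantError {Ω S : Type*} [MeasurableSpace Ω] (r : ℝ) (P : Measure Ω) (X : Ω → S)
    (ρ : S → S → ℝ≥0∞) (s : ℝ) : ℝ≥0∞ :=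
  ⨅ (C : Finset S) (_ : C.Nonempty) (_ : Real.log (C.card : ℝ) ≤ r),
    (∫⁻ ω, ⨅ a ∈ C, ρ (X ω) a ^ s ∂P) ^ (1 / s)

/-- The inverse concept `d^{(q)}`: the least `n ≥ 1` with `D^{(q)}(log n) ≤ ε`, and `⊤` if there
is no such `n`. -/
def quantNumber {Ω S : Type*} [MeasurableSpace Ω] (ε : ℝ) (P : Measure Ω) (X : Ω → S)
    (ρ : S → S → ℝ≥0∞) (s : ℝ) : ℕ∞ :=
  ⨅ (n : ℕ) (_ : 1 ≤ n) (_ : quantError (Real.log (n : ℝ)) P X ρ s ≤ ENNReal.ofReal ε), (n : ℕ∞)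

open Classical in
/-- The discrete entropy (in nats): `- ∑ₓ P(X = x) log P(X = x)` if `X` is discrete, that is, if
`X` lies almost surely in a countable set, and `∞` otherwise. -/
def discreteEntropy {Ω S : Type*} [MeasurableSpace Ω] (P : Measure Ω) (X : Ω → S) : ℝ≥0∞ :=
  if ∃ A : Set S, A.Countable ∧ ∀ᵐ ω ∂P, X ω ∈ A then
    ∑' x : S, ENNReal.ofReal (Real.negMulLog (P.real (X ⁻¹' {x})))
  else ⊤

/-- The entropy coding error: the infimum of `(𝔼 ρ(X,X̂)^s)^{1/s}` over all random variables `X̂`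
on the underlying probability space with entropy at most `r`. -/
def entropyError {Ω S : Type*} [MeasurableSpace Ω] [MeasurableSpace S] (r : ℝ) (P : Measure Ω)
    (X : Ω → S) (ρ : S → S → ℝ≥0∞) (s : ℝ) : ℝ≥0∞ :=
  ⨅ (X' : Ω → S) (_ : Measurable X') (_ : (discreteEntropy P X' : EReal) ≤ (r : EReal)),
    (∫⁻ ω, ρ (X ω) (X' ω) ^ s ∂P) ^ (1 / s)

/-- `f ≳ g` as `r → ∞`: `liminf f / g ≥ 1`. -/
def AsympGE (f : ℝ → EReal) (g : ℝ → ℝ) : Prop :=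
  1 ≤ liminf (fun r => f r / (g r : EReal)) atTop

/-- The norm distortion `ρ(x,y) = ‖x - y‖`. -/
def normDist {E : Type*} [NormedAddCommGroup E] (x y : E) : ℝ≥0∞ := ‖x - y‖ₑ

/-! ### Step paths and their jumps -/

/-- `f : [0,1[ → E` is piecewise constant with finitely many jumps, and at a jump it takes the new
value: for a finite set `T` of times, `f x = f y` as soon as `]x, y]` contains no point of `T`. -/
def IsStepPath {E : Type*} (f : Set.Ico (0 : ℝ) 1 → E) : Prop :=
  ∃ T : Finset ℝ, ∀ x y : Set.Ico (0 : ℝ) 1, x ≤ y → (∀ t ∈ T, ¬ ((x : ℝ) < t ∧ t ≤ y)) → f x = f y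

/-- The space `𝔻([0,1[, E)`.  As a subtype of a function space it carries the `σ`-field induced by
the projections `f ↦ f t`. -/
abbrev StepPath (E : Type*) : Type _ := {f : Set.Ico (0 : ℝ) 1 → E // IsStepPath f}

/-- The distortion `ρ_𝔻(f,g) = ∫₀¹ ρ(f(t),g(t)) dt`. -/
def pathDist {E : Type*} (ρ : E → E → ℝ≥0∞) (f g : StepPath E) : ℝ≥0∞ :=
  ∫⁻ t : Set.Ico (0 : ℝ) 1, ρ (f.1 t) (g.1 t) ∂(Measure.comap Subtype.val volume)

/-- The set of jump positions: the times `t` such that `f` is not equal to `f t` immediately before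
`t`.  (There is nothing before `0`, so `0` is never a jump position.) -/
def jumpSet {E : Type*} (f : StepPath E) : Set (Set.Ico (0 : ℝ) 1) :=
  {t | ¬ ∀ᶠ u in 𝓝[<] t, f.1 u = f.1 t}

theorem jumpSet_finite {E : Type*} (f : StepPath E) : (jumpSet f).Finite := by
  obtain ⟨T, hT⟩ := f.2
  refine Set.Finite.subset (T.finite_toSet.preimage Subtype.val_injective.injOn) ?_
  intro t ht
  by_contra hnot
  apply ht
  have hnT : (t : ℝ) ∉ T := by simpa using hnot
  have h1 : ∀ s ∈ T, ∀ᶠ u : Set.Ico (0 : ℝ) 1 in 𝓝[<] t, ¬ ((u : ℝ) < s ∧ s ≤ t) := by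
    intro s hs
    rcases lt_or_ge (t : ℝ) s with h | h
    · exact Eventually.of_forall fun u hu => absurd hu.2 (not_le.2 h)
    · have hlt : s < (t : ℝ) := lt_of_le_of_ne h (fun e => hnT (e ▸ hs))
      have : ∀ᶠ u : Set.Ico (0 : ℝ) 1 in 𝓝 t, s < (u : ℝ) :=
        continuous_subtype_val.continuousAt.eventually (lt_mem_nhds hlt)
      exact (this.filter_mono nhdsWithin_le_nhds).mono fun u hu h2 => absurd h2.1 (not_lt.2 hu.le)
  have h2 : ∀ᶠ u : Set.Ico (0 : ℝ) 1 in 𝓝[<] t, ∀ s ∈ T, ¬ ((u : ℝ) < s ∧ s ≤ t) :=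
    (T.eventually_all).2 h1
  filter_upwards [h2, self_mem_nhdsWithin] with u hu hlt
  exact hT u t (le_of_lt hlt) hu

/-- The number of jumps `N_f` (the set of jump positions is finite). -/
def numJumps {E : Type*} (f : StepPath E) : ℕ := (jumpSet f).ncard

/-- The positions `0 = Y₀ < Y₁ < ⋯ < Y_N < Y_{N+1} = 1`: `Y_{i+1}` is the first jump position after
`Y_i`, and `1` if there is none. -/
def jumpTime {E : Type*} (f : StepPath E) : ℕ → ℝ
  | 0 => 0
  | i + 1 => sInf (insert 1 (Subtype.val '' {u ∈ jumpSet f | jumpTime f i < (u : ℝ)}))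

open Classical in
/-- The jump destination `f(Y_i)`; meaningful for `i ≤ N_f`, where `Y_i ∈ [0,1[`. -/
def jumpDest {E : Type*} [Zero E] (f : StepPath E) (i : ℕ) : E :=
  if h : jumpTime f i ∈ Set.Ico (0 : ℝ) 1 then f.1 ⟨jumpTime f i, h⟩ else 0

/-- The increments, numbered from zero: `increment f i = f(Y_{i+1}) - f(Y_i)`, for `i < N_f`. -/
def increment {E : Type*} [NormedAddCommGroup E] (f : StepPath E) (i : ℕ) : E :=
  jumpDest f (i + 1) - jumpDest f i

/-! ### The model -/

/-- The standing assumptions on the jump process `X` with values in a normed space, where `ζ` is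
an `E`-valued random variable (on some probability space) having the law of the increments. -/
structure IsJumpModel {Ω Ω' E : Type*} [MeasurableSpace Ω] [MeasurableSpace Ω']
    [NormedAddCommGroup E] [MeasurableSpace E]
    (P : Measure Ω) (X : Ω → StepPath E) (P' : Measure Ω') (ζ : Ω' → E) (K lam : ℝ) : Prop where
  measurable_path : Measurable X
  measurable_incr : Measurable ζ
  lam_pos : 0 < lam
  one_le_K : 1 ≤ K
  /-- The jump counts are bounded by Poisson weights. -/
  count_le : ∀ k : ℕ, P.real {ω | numJumps (X ω) = k} ≤
    lam ^ k / (k.factorial : ℝ) * Real.exp (-lam) * K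
  /-- `X(0)` is deterministic. -/
  start : ∃ x₀ : E, ∀ᵐ ω ∂P, (X ω).1 ⟨0, by norm_num⟩ = x₀
  /-- Given `N_X = k`, the vector of jump positions `(Y₁, …, Y_k)` is independent of the vector of
  jump destinations `(X(Y₀), …, X(Y_k))`. -/
  indep : ∀ k : ℕ, P {ω | numJumps (X ω) = k} ≠ 0 →
    IndepFun (fun ω (i : Fin k) => jumpTime (X ω) (i + 1))
      (fun ω (i : Fin (k + 1)) => jumpDest (X ω) i) (ProbabilityTheory.cond P {ω | numJumps (X ω) = k})
  /-- Given `N_X = k`, each of the `k` increments has the law of `ζ`. -/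
  incr_law : ∀ k : ℕ, P {ω | numJumps (X ω) = k} ≠ 0 → ∀ i < k,
    IdentDistrib (fun ω => increment (X ω) i) ζ (ProbabilityTheory.cond P {ω | numJumps (X ω) = k}) P'

end

/-! On `{N_X = k}` a path is coded by rounding its jump times down to a grid of `m` points and
replacing each increment by a nearest point of an `n`-point codebook for `ζ`. The error is at most
`∑ᵢ (‖Zᵢ - ẑᵢ‖ + ‖Zᵢ‖ / m)` (`pathDist_codePath_le`), so its `s`-th moment on that event is at most
`P(N_X = k)` times a power of `k` times a quantity depending on `ζ` alone
(`IsJumpModel.setLIntegral_pathDist_le`). Accuracy `e^{-u}` costs about `u` nats per jump time and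
`log d(e^{-u})` nats per increment.

For (b) the accuracy is the same for all `k`. Code words with `k` jumps get weight `2^{-k-1}
(mn)^{-k}`; Gibbs' inequality (`discreteEntropy_comp_le`) bounds the entropy by the mean of `-log`
weight, which is linear in `𝔼 N_X ≤ Kλ`. The surplus terms `log 2` are paid for by coarsening the
grid by a constant factor, which only affects `C`.

For (a) the size of the codebook counts, so unlikely large `k` get poorer accuracy: with `u_k = D -
log(k!/(2λ)^k)/s`, the product `P(N_X = k) e^{-s u_k}` is at most a constant times `2^{-k} e^{-sD}`,
and the total error is `O(e^{-D})`. For `g > γ` and `Γ = 1 + g`, the `k`-th codebook has log-size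
about `kΓ(D - k log k / s)`. For the `k` that matter `log k ≈ log D`, and the quadratic in `k` peaks
at `k ≈ sD/(2 log D)` with value `sΓD²/(4 log D)` (`eventually_rate_le`). Only `O(D)` values of `k`
have `u_k ≥ 0`, so uniting the codebooks costs a negligible `O(log D)`. Solving `r = sΓD²/(4 log D)`
gives `log r ~ 2 log D` and `D ~ √(2 r log r / (sΓ))` (`asympGE_of_eventually_le`). A parameter `p <
1` carries all the losses, with `Γ = (1 + γ)/p`, and tends to `1` at the end. -/

noncomputable section

/-! ### The jump structure of a step path -/

section Paths

variable {E : Type*}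

/-- A step path is constant on intervals without jumps. -/
theorem StepPath.eq_of_no_jump (f : StepPath E) {x y : Set.Ico (0 : ℝ) 1} (hxy : x ≤ y)
    (h : ∀ u ∈ jumpSet f, ¬ (x < u ∧ u ≤ y)) : f.1 x = f.1 y := by
  obtain ⟨T, hT⟩ := f.2
  -- `T` may contain times that are not jumps. The last point `t` of `T` in `]x, y]` is removed by
  -- moving to a time `u < t` with the same value.
  induction hn : (T.filter fun t => (x : ℝ) < t ∧ t ≤ y).card using Nat.strong_induction_on
    generalizing y with
  | _ n ih =>
    rcases (T.filter fun t => (x : ℝ) < t ∧ t ≤ y).eq_empty_or_nonempty with he | hne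
    · refine hT x y hxy fun t ht hh => ?_
      have : t ∈ T.filter fun t => (x : ℝ) < t ∧ t ≤ y := Finset.mem_filter.2 ⟨ht, hh⟩
      simp [he] at this
    · set t := (T.filter fun t => (x : ℝ) < t ∧ t ≤ y).max' hne with htdef
      have htm := Finset.max'_mem _ hne
      rw [← htdef, Finset.mem_filter] at htm
      obtain ⟨htT, hxt, hty⟩ := htm
      have htI : t ∈ Set.Ico (0 : ℝ) 1 := ⟨x.2.1.trans hxt.le, hty.trans_lt y.2.2⟩
      let t' : Set.Ico (0 : ℝ) 1 := ⟨t, htI⟩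
      have hnj : t' ∉ jumpSet f := fun hj => h t' hj ⟨hxt, hty⟩
      have hev : ∀ᶠ u in 𝓝[<] t', f.1 u = f.1 t' := by
        by_contra hc; exact hnj hc
      have hnb : (𝓝[<] t').NeBot := by
        exact nhdsLT_neBot_of_exists_lt ⟨x, hxt⟩
      have hx' : ∀ᶠ u in 𝓝[<] t', x < u :=
        (lt_mem_nhds (show x < t' from hxt)).filter_mono nhdsWithin_le_nhds
      obtain ⟨u, ⟨hu1, hu2⟩, hu3⟩ := ((hev.and hx').and self_mem_nhdsWithin).exists
      have hty' : f.1 t' = f.1 y := by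
        refine hT t' y hty fun a ha hh => ?_
        have := Finset.le_max' (T.filter fun t => (x : ℝ) < t ∧ t ≤ y) a
          (Finset.mem_filter.2 ⟨ha, hxt.trans hh.1, hh.2⟩)
        exact absurd hh.1 (not_lt.2 this)
      rw [← hty', ← hu1]
      have hut : (u : ℝ) < t := hu3
      refine ih _ ?_ hu2.le (fun v hv hh => h v hv ⟨hh.1, hh.2.trans (hut.le.trans hty)⟩) rfl
      rw [← hn]
      refine Finset.card_lt_card ⟨fun a ha => ?_, fun hsub => ?_⟩
      · rw [Finset.mem_filter] at ha ⊢
        exact ⟨ha.1, ha.2.1, ha.2.2.trans (hut.le.trans hty)⟩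
      · have := hsub (Finset.mem_filter.2 ⟨htT, hxt, hty⟩)
        rw [Finset.mem_filter] at this
        exact absurd this.2.2 (not_le.2 hut)

/-- Immediately before a jump, a step path takes a different value. -/
theorem StepPath.exists_ne_of_jump (f : StepPath E) {x t : Set.Ico (0 : ℝ) 1} (ht : t ∈ jumpSet f)
    (hxt : x < t) : ∃ u, x < u ∧ u < t ∧ ∀ v, u ≤ v → v < t → f.1 v ≠ f.1 t := by
  have hfin := (jumpSet_finite f).subset (Set.inter_subset_left (t := Set.Ioo x t))
  have hev : ∀ᶠ u in 𝓝[<] t, x < u ∧ ∀ v ∈ jumpSet f ∩ Set.Ioo x t, v < u := by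
    refine ((lt_mem_nhds hxt).filter_mono nhdsWithin_le_nhds).and
      ((Set.Finite.eventually_all hfin).2 fun v hv =>
        (lt_mem_nhds hv.2.2).filter_mono nhdsWithin_le_nhds)
  have hfr : ∃ᶠ u in 𝓝[<] t, f.1 u ≠ f.1 t := by
    intro hc
    exact ht (hc.mono fun u hu => not_not.1 hu)
  obtain ⟨u, hu1, ⟨hu2, hu3⟩, hu4⟩ := (hfr.and_eventually (hev.and self_mem_nhdsWithin)).exists
  refine ⟨u, hu2, hu4, fun v huv hvt => ?_⟩
  -- No jump lies between `u` and `t`, so one value different from `f t` is the value on all of `[u,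
  -- t[`.
  rw [← f.eq_of_no_jump huv fun w hw hh => ?_]
  · exact hu1
  · exact absurd (hu3 w ⟨hw, hu2.trans hh.1, hh.2.trans_lt hvt⟩) (not_lt.2 hh.1.le)

theorem jumpTime_zero (f : StepPath E) : jumpTime f 0 = 0 := by rw [jumpTime]

/-- The infimum runs over a finite nonempty set, hence is attained: `Y_{i+1}` is an actual jump or
the default `1`. -/
theorem jumpTime_succ_mem (f : StepPath E) (i : ℕ) : jumpTime f (i + 1) ∈
    insert 1 (Subtype.val '' {u ∈ jumpSet f | jumpTime f i < (u : ℝ)}) := by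
  rw [jumpTime]
  refine Set.Nonempty.csInf_mem (Set.insert_nonempty _ _) ?_
  exact (((jumpSet_finite f).subset (Set.sep_subset _ _)).image _).insert _

theorem bddBelow_later_jumps (f : StepPath E) (i : ℕ) :
    BddBelow (insert 1 (Subtype.val '' {u ∈ jumpSet f | jumpTime f i < (u : ℝ)})) :=
  ((((jumpSet_finite f).subset (Set.sep_subset _ _)).image _).insert _).bddBelow

theorem jumpTime_succ_le_one (f : StepPath E) (i : ℕ) : jumpTime f (i + 1) ≤ 1 := by
  rw [jumpTime]
  exact csInf_le (bddBelow_later_jumps f i) (Set.mem_insert _ _)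

theorem jumpTime_le_one (f : StepPath E) (i : ℕ) : jumpTime f i ≤ 1 := by
  cases i with
  | zero => rw [jumpTime_zero]; norm_num
  | succ i => exact jumpTime_succ_le_one f i

theorem jumpTime_succ_le (f : StepPath E) {i : ℕ} {u : Set.Ico (0 : ℝ) 1} (hu : u ∈ jumpSet f)
    (h : jumpTime f i < u) : jumpTime f (i + 1) ≤ u := by
  rw [jumpTime]
  exact csInf_le (bddBelow_later_jumps f i) (Set.mem_insert_of_mem _ ⟨u, ⟨hu, h⟩, rfl⟩)

theorem exists_jump_of_jumpTime_lt (f : StepPath E) {i : ℕ} (h : jumpTime f (i + 1) < 1) :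
    ∃ u ∈ jumpSet f, jumpTime f i < u ∧ (u : ℝ) = jumpTime f (i + 1) := by
  rcases jumpTime_succ_mem f i with h1 | ⟨u, ⟨hu, hlt⟩, he⟩
  · exact absurd h1 h.ne
  · exact ⟨u, hu, hlt, he⟩

theorem jumpTime_lt_succ (f : StepPath E) {i : ℕ} (h : jumpTime f i < 1) :
    jumpTime f i < jumpTime f (i + 1) := by
  rcases (jumpTime_succ_le_one f i).lt_or_eq with h1 | h1
  · obtain ⟨u, -, hlt, he⟩ := exists_jump_of_jumpTime_lt f h1
    rwa [← he]
  · rwa [h1]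

theorem jumpTime_mono (f : StepPath E) : Monotone (jumpTime f) := by
  refine monotone_nat_of_le_succ fun i => ?_
  rcases (jumpTime_succ_le_one f i).lt_or_eq with h1 | h1
  · obtain ⟨u, -, hlt, he⟩ := exists_jump_of_jumpTime_lt f h1
    rw [← he]; exact hlt.le
  · rw [h1]; exact jumpTime_le_one f i

theorem jumpTime_nonneg (f : StepPath E) (i : ℕ) : 0 ≤ jumpTime f i := by
  rw [← jumpTime_zero f]; exact jumpTime_mono f (Nat.zero_le i)

/-- `0` is not a jump position. -/
theorem pos_of_mem_jumpSet (f : StepPath E) {u : Set.Ico (0 : ℝ) 1} (hu : u ∈ jumpSet f) :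
    0 < (u : ℝ) := by
  refine lt_of_le_of_ne u.2.1 fun h => hu ?_
  have : Set.Iio u = ∅ := by
    ext v
    simp only [Set.mem_Iio, Set.mem_empty_iff_false, iff_false, not_lt]
    exact (Subtype.coe_le_coe).1 (h ▸ v.2.1)
  rw [this, nhdsWithin_empty]
  exact eventually_bot

/-- If `Y_i < 1`, exactly `i` jumps happen up to time `Y_i`. -/
theorem ncard_jumps_le (f : StepPath E) : ∀ i, jumpTime f i < 1 →
    {u ∈ jumpSet f | (u : ℝ) ≤ jumpTime f i}.ncard = i
  | 0, _ => by
    convert Set.ncard_empty (Set.Ico (0 : ℝ) 1)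
    ext u
    simp only [Set.mem_ofPred_eq, Set.mem_empty_iff_false, iff_false, not_and, not_le, jumpTime_zero]
    exact fun hu => pos_of_mem_jumpSet f hu
  | i + 1, h => by
    have hi := ncard_jumps_le f i ((jumpTime_mono f (Nat.le_succ i)).trans_lt h)
    obtain ⟨v, hv, hlt, he⟩ := exists_jump_of_jumpTime_lt f h
    have : {u ∈ jumpSet f | (u : ℝ) ≤ jumpTime f (i + 1)} =
        insert v {u ∈ jumpSet f | (u : ℝ) ≤ jumpTime f i} := by
      ext u
      simp only [Set.mem_ofPred_eq, Set.mem_insert_iff]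
      constructor
      · rintro ⟨hu, hle⟩
        rcases le_or_gt (u : ℝ) (jumpTime f i) with h1 | h1
        · exact Or.inr ⟨hu, h1⟩
        · exact Or.inl (Subtype.ext (le_antisymm (hle.trans he.ge)
            (he.le.trans (jumpTime_succ_le f hu h1))))
      · rintro (rfl | ⟨hu, h1⟩)
        · exact ⟨hv, he.le⟩
        · exact ⟨hu, h1.trans (jumpTime_mono f (Nat.le_succ i))⟩
    rw [this, Set.ncard_insert_of_notMem (fun hh => absurd hh.2 (not_le.2 hlt))
      ((jumpSet_finite f).subset (Set.sep_subset _ _)), hi]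

/-- Turns a cardinality into two conditions on jump times, the form in which the count is measurable
and usable. -/
theorem numJumps_eq_iff (f : StepPath E) (k : ℕ) :
    numJumps f = k ↔ jumpTime f k < 1 ∧ jumpTime f (k + 1) = 1 := by
  have key : ∀ i, jumpTime f i < 1 → jumpTime f (i + 1) = 1 → numJumps f = i := by
    intro i h1 h2
    rw [← ncard_jumps_le f i h1, numJumps]
    congr 1
    ext u
    simp only [Set.mem_ofPred_eq, iff_self_and]
    intro hu
    by_contra hlt
    have h3 := jumpTime_succ_le f hu (not_le.1 hlt)
    rw [h2] at h3
    exact absurd h3 (not_le.2 u.2.2)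
  refine ⟨fun h => ?_, fun h => key k h.1 h.2⟩
  -- Otherwise `N + 1` jumps would occur up to `Y_{N+1}`, one more than there are.
  have hex : ∃ i, jumpTime f (i + 1) = 1 := by
    refine ⟨numJumps f, (jumpTime_succ_le_one f _).eq_of_not_lt fun hlt => ?_⟩
    have h1 := ncard_jumps_le f _ hlt
    have h2 : {u ∈ jumpSet f | (u : ℝ) ≤ jumpTime f (numJumps f + 1)}.ncard ≤ numJumps f :=
      Set.ncard_le_ncard (Set.sep_subset _ _) (jumpSet_finite f)
    omega
  classical
  have h1 := Nat.find_spec hex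
  have h2 : jumpTime f (Nat.find hex) < 1 := by
    rcases hc : Nat.find hex with _ | j
    · rw [jumpTime_zero]; norm_num
    · exact (jumpTime_succ_le_one f j).lt_of_ne (Nat.find_min hex (by omega))
  have := key _ h2 h1
  rw [h] at this
  rw [this]
  exact ⟨h2, h1⟩

theorem StepPath.eq_jumpDest [Zero E] (f : StepPath E) {i : ℕ} {t : Set.Ico (0 : ℝ) 1}
    (h1 : jumpTime f i ≤ t) (h2 : t < jumpTime f (i + 1)) : f.1 t = jumpDest f i := by
  have hI : jumpTime f i ∈ Set.Ico (0 : ℝ) 1 := ⟨jumpTime_nonneg f i, h1.trans_lt t.2.2⟩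
  rw [jumpDest, dif_pos hI]
  refine (f.eq_of_no_jump h1 fun u hu hh => ?_).symm
  have hle := jumpTime_succ_le f hu hh.1
  have hut : (u : ℝ) ≤ t := hh.2
  linarith

theorem jumpDest_zero [Zero E] (f : StepPath E) :
    jumpDest f 0 = f.1 ⟨0, by norm_num⟩ := by
  have : jumpTime f 0 ∈ Set.Ico (0 : ℝ) 1 := by rw [jumpTime_zero]; norm_num
  rw [jumpDest, dif_pos this]
  congr 2

theorem jumpDest_eq_sum [NormedAddCommGroup E] (f : StepPath E) (j : ℕ) :
    jumpDest f j = jumpDest f 0 + ∑ i ∈ Finset.range j, increment f i := by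
  simp only [increment, Finset.sum_range_sub]
  abel

/-- A step path is the sum of its increments. -/
theorem StepPath.eq_sum_increment [NormedAddCommGroup E] (f : StepPath E) {k : ℕ}
    (hk : numJumps f = k) (t : Set.Ico (0 : ℝ) 1) :
    f.1 t = f.1 ⟨0, by norm_num⟩ +
      ∑ i : Fin k, if jumpTime f (i + 1) ≤ t then increment f i else 0 := by
  obtain ⟨-, hk2⟩ := (numJumps_eq_iff f k).1 hk
  have hex : ∃ j, (t : ℝ) < jumpTime f (j + 1) := ⟨k, by rw [hk2]; exact t.2.2⟩
  classical
  obtain ⟨j, hj, hmin⟩ : ∃ j, (t : ℝ) < jumpTime f (j + 1) ∧ ∀ i < j, jumpTime f (i + 1) ≤ t :=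
    ⟨Nat.find hex, Nat.find_spec hex, fun i hi => not_lt.1 (Nat.find_min hex hi)⟩
  have hjk : j ≤ k := by
    by_contra hlt
    have := hmin k (not_le.1 hlt)
    rw [hk2] at this
    exact absurd this (not_le.2 t.2.2)
  have hjt : jumpTime f j ≤ t := by
    cases j with
    | zero => rw [jumpTime_zero]; exact t.2.1
    | succ j => exact hmin j (Nat.lt_succ_self j)
  rw [f.eq_jumpDest hjt hj, jumpDest_eq_sum, jumpDest_zero,
    Fin.sum_univ_eq_sum_range (fun i => if jumpTime f (i + 1) ≤ t then increment f i else 0) k,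
    ← Finset.sum_filter]
  congr 2
  ext i
  simp only [Finset.mem_range, Finset.mem_filter]
  refine ⟨fun hi => ⟨hi.trans_le hjk, hmin i hi⟩, fun hi => ?_⟩
  by_contra hc
  have := jumpTime_mono f (show j + 1 ≤ i + 1 by omega)
  linarith [hi.2]

end Paths

/-! ### Measurability of the jump structure -/

section Measurability

/-- The rational times in `[0,1[`. -/
def ratTimes : Set (Set.Ico (0 : ℝ) 1) := {u | ∃ a : ℚ, (a : ℝ) = u}

theorem ratTimes_countable : ratTimes.Countable :=
  (Set.countable_range ((↑) : ℚ → ℝ)).preimage Subtype.val_injective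

theorem exists_ratTimes_between {x y : ℝ} (hx : 0 ≤ x) (hy : y ≤ 1) (h : x < y) :
    ∃ q ∈ ratTimes, x < (q : ℝ) ∧ (q : ℝ) < y := by
  obtain ⟨a, h1, h2⟩ := exists_rat_btwn h
  exact ⟨⟨a, hx.trans h1.le, h2.trans_le hy⟩, ⟨a, rfl⟩, h1, h2⟩

variable {E : Type*}

theorem StepPath.exists_const_right (f : StepPath E) (u : Set.Ico (0 : ℝ) 1) :
    ∃ v : ℝ, (u : ℝ) < v ∧ v ≤ 1 ∧ ∀ w : Set.Ico (0 : ℝ) 1, u ≤ w → (w : ℝ) < v → f.1 w = f.1 u := by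
  have hfin : {w ∈ jumpSet f | u < w}.Finite := (jumpSet_finite f).subset (Set.sep_subset _ _)
  have hmem := Set.Nonempty.csInf_mem (Set.insert_nonempty (1 : ℝ) _)
    ((hfin.image Subtype.val).insert 1)
  have hbdd := ((hfin.image Subtype.val).insert (1 : ℝ)).bddBelow
  refine ⟨_, ?_, csInf_le hbdd (Set.mem_insert _ _), fun w huw hw => ?_⟩
  · rcases hmem with h | ⟨w, hw, he⟩
    · rw [h]; exact u.2.2
    · rw [← he]; exact hw.2
  · refine (f.eq_of_no_jump huw fun x hx hh => ?_).symm
    have h1 := csInf_le hbdd (Set.mem_insert_of_mem _ ⟨x, ⟨hx, hh.1⟩, rfl⟩)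
    have h2 : (x : ℝ) ≤ w := hh.2
    linarith

/-- A jump in `]Y_i, t]` is detected by two different values at countably many candidate times,
because the path is constant just before and just after a jump. The time `t` itself must be a
candidate: the jump may occur exactly at an irrational `t`. -/
theorem jumpTime_succ_le_iff (f : StepPath E) (i : ℕ) (t : Set.Ico (0 : ℝ) 1) :
    jumpTime f (i + 1) ≤ t ↔ ∃ q ∈ insert t ratTimes, ∃ q' ∈ insert t ratTimes,
      jumpTime f i ≤ q ∧ q ≤ q' ∧ q' ≤ t ∧ f.1 q ≠ f.1 q' := by
  constructor
  · intro h
    obtain ⟨u, hu, hlt, he⟩ := exists_jump_of_jumpTime_lt f (h.trans_lt t.2.2)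
    rw [← he] at h
    have hxI : jumpTime f i ∈ Set.Ico (0 : ℝ) 1 := ⟨jumpTime_nonneg f i, hlt.trans u.2.2⟩
    obtain ⟨v, hv1, hv2, hv3⟩ := f.exists_ne_of_jump (x := ⟨_, hxI⟩) hu hlt
    obtain ⟨q, hq, hq1, hq2⟩ := exists_ratTimes_between v.2.1 u.2.2.le hv2
    have hqne := hv3 q hq1.le hq2
    have hTq : jumpTime f i ≤ q := (show jumpTime f i < v from hv1).le.trans hq1.le
    rcases h.lt_or_eq with hlt' | heq
    · obtain ⟨b, hb1, hb2, hb3⟩ := f.exists_const_right u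
      obtain ⟨q', hq', hq1', hq2'⟩ := exists_ratTimes_between u.2.1
        ((min_le_left b t).trans hb2) (lt_min hb1 hlt')
      refine ⟨q, Or.inr hq, q', Or.inr hq', hTq, (hq2.trans hq1').le,
        (hq2'.trans_le (min_le_right _ _)).le, ?_⟩
      rwa [hb3 q' hq1'.le (hq2'.trans_le (min_le_left _ _))]
    · have : u = t := Subtype.ext heq
      subst this
      exact ⟨q, Or.inr hq, u, Or.inl rfl, hTq, hq2.le, le_rfl, hqne⟩
  · rintro ⟨q, -, q', -, h1, h2, h3, h4⟩
    have : ∃ u ∈ jumpSet f, q < u ∧ u ≤ q' := by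
      by_contra hc
      push Not at hc
      exact h4 (f.eq_of_no_jump h2 fun u hu hh => absurd hh.2 (not_le.2 (hc u hu hh.1)))
    obtain ⟨u, hu, hu1, hu2⟩ := this
    exact (jumpTime_succ_le f hu (h1.trans_lt hu1)).trans (hu2.trans h3)

variable [MeasurableSpace E]

theorem measurable_evalPath (t : Set.Ico (0 : ℝ) 1) :
    Measurable (fun f : StepPath E => f.1 t) :=
  (measurable_pi_apply t).comp measurable_subtype_coe

variable [NormedAddCommGroup E] [MeasurableSub₂ E]

/-- Induction through `jumpTime_succ_le_iff`. Difference of two values is expressed by `‖·‖ ≠ 0`, so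
measurability of subtraction and norm replaces measurability of the diagonal of `E`. -/
theorem measurable_jumpTime (hn : Measurable (fun x : E => ‖x‖)) :
    ∀ i, Measurable (fun f : StepPath E => jumpTime f i)
  | 0 => by simp only [jumpTime_zero]; exact measurable_const
  | i + 1 => by
    have ih := measurable_jumpTime hn i
    refine measurable_of_Iic fun t => ?_
    rcases lt_or_ge t 0 with h0 | h0
    · convert MeasurableSet.empty
      ext f
      simpa using h0.trans_le (jumpTime_nonneg f (i + 1))
    rcases lt_or_ge t 1 with h1 | h1
    · have : (fun f : StepPath E => jumpTime f (i + 1)) ⁻¹' Set.Iic t =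
          ⋃ q ∈ insert (⟨t, h0, h1⟩ : Set.Ico (0 : ℝ) 1) ratTimes,
          ⋃ q' ∈ insert (⟨t, h0, h1⟩ : Set.Ico (0 : ℝ) 1) ratTimes,
            {f : StepPath E | jumpTime f i ≤ q ∧ q ≤ q' ∧ q' ≤ ⟨t, h0, h1⟩ ∧
              ‖f.1 q - f.1 q'‖ ≠ 0} := by
        ext f
        simp only [Set.mem_iUnion, Set.mem_ofPred_eq, Set.mem_preimage, Set.mem_Iic,
          norm_ne_zero_iff, sub_ne_zero, exists_prop]
        exact jumpTime_succ_le_iff f i ⟨t, h0, h1⟩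
      rw [this]
      refine MeasurableSet.biUnion (ratTimes_countable.insert _) fun q _ =>
        MeasurableSet.biUnion (ratTimes_countable.insert _) fun q' _ => ?_
      refine (measurableSet_le ih measurable_const).inter ((MeasurableSet.const _).inter
        ((MeasurableSet.const _).inter ?_))
      exact (measurableSet_eq_fun (hn.comp ((measurable_evalPath q).sub (measurable_evalPath q')))
        measurable_const).compl
    · convert MeasurableSet.univ
      ext f
      simpa using (jumpTime_le_one f (i + 1)).trans h1

/-- The destination is read off at a rational time in the constancy interval `[Y_i, Y_{i+1}[`; the
second set accounts for the default value `0` when `Y_i = 1`. -/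
theorem measurable_jumpDest (hn : Measurable (fun x : E => ‖x‖)) (i : ℕ) :
    Measurable (fun f : StepPath E => jumpDest f i) := by
  intro B hB
  have : (fun f : StepPath E => jumpDest f i) ⁻¹' B =
      (⋃ q ∈ ratTimes, {f : StepPath E | jumpTime f i ≤ q ∧ (q : ℝ) < jumpTime f (i + 1) ∧
        f.1 q ∈ B}) ∪ {f : StepPath E | 1 ≤ jumpTime f i ∧ (0 : E) ∈ B} := by
    ext f
    simp only [Set.mem_preimage, Set.mem_union, Set.mem_iUnion, Set.mem_ofPred_eq, exists_prop]
    rcases lt_or_ge (jumpTime f i) 1 with h | h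
    · constructor
      · intro hB
        obtain ⟨q, hq, hq1, hq2⟩ := exists_ratTimes_between (jumpTime_nonneg f i)
          (jumpTime_le_one f (i + 1)) (jumpTime_lt_succ f h)
        exact Or.inl ⟨q, hq, hq1.le, hq2, by rwa [f.eq_jumpDest hq1.le hq2]⟩
      · rintro (⟨q, -, h1, h2, h3⟩ | h')
        · rwa [← f.eq_jumpDest h1 h2]
        · exact absurd h'.1 (not_le.2 h)
    · have hd : jumpDest f i = 0 := by
        rw [jumpDest, dif_neg (fun hI => absurd hI.2 (not_lt.2 h))]
      rw [hd]
      constructor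
      · exact fun hB => Or.inr ⟨h, hB⟩
      · rintro (⟨q, -, h1, -⟩ | h')
        · exact absurd q.2.2 (not_lt.2 (h.trans h1))
        · exact h'.2
  rw [this]
  refine (MeasurableSet.biUnion ratTimes_countable fun q _ => ?_).union ?_
  · exact (measurableSet_le (measurable_jumpTime hn i) measurable_const).inter
      ((measurableSet_lt measurable_const (measurable_jumpTime hn (i + 1))).inter
        (measurable_evalPath q hB))
  · exact (measurableSet_le measurable_const (measurable_jumpTime hn i)).inter
      (MeasurableSet.const _)

theorem measurable_increment (hn : Measurable (fun x : E => ‖x‖)) (i : ℕ) :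
    Measurable (fun f : StepPath E => increment f i) :=
  (measurable_jumpDest hn (i + 1)).sub (measurable_jumpDest hn i)

theorem measurable_numJumps (hn : Measurable (fun x : E => ‖x‖)) :
    Measurable (fun f : StepPath E => numJumps f) := by
  refine measurable_to_countable' fun k => ?_
  have : (fun f : StepPath E => numJumps f) ⁻¹' {k} =
      {f | jumpTime f k < 1} ∩ {f | jumpTime f (k + 1) = 1} := by
    ext f
    exact numJumps_eq_iff f k
  rw [this]
  exact (measurableSet_lt (measurable_jumpTime hn k) measurable_const).inter
    (measurableSet_eq_fun (measurable_jumpTime hn (k + 1)) measurable_const)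

end Measurability

/-! ### Code paths and their distortion -/

section CodePaths

variable {E : Type*} [NormedAddCommGroup E]

/-- The step path that starts in `x₀` and jumps by `z i` at time `p i`. -/
def codePath (x₀ : E) {k : ℕ} (p : Fin k → ℝ) (z : Fin k → E) : StepPath E :=
  ⟨fun t => x₀ + ∑ i, (if p i ≤ t then z i else 0 : E), Finset.univ.image p, fun x y hxy h => by
    refine congrArg (x₀ + ·) (Finset.sum_congr rfl fun i _ => ?_)
    have hi := h (p i) (Finset.mem_image_of_mem p (Finset.mem_univ i))
    have hxy' : (x : ℝ) ≤ y := hxy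
    congr 1
    rw [eq_iff_iff]
    refine ⟨fun hp => hp.trans hxy', fun hp => ?_⟩
    by_contra hc
    exact hi ⟨not_le.1 hc, hp⟩⟩

/-- Lets the estimates for general codes be applied to the trivial code, whose output is the same
path for every number of jumps. -/
theorem codePath_zero (x₀ : E) {k l : ℕ} (p : Fin k → ℝ) (p' : Fin l → ℝ) :
    codePath x₀ p (fun _ => 0) = codePath x₀ p' (fun _ => 0) := by
  apply Subtype.ext
  funext t
  simp [codePath]

/-- The code jumps early. The `i`-th contributions differ by nothing before `p i`, by `z i` on `[p
i, Y_{i+1}[`, and by `increment f i - z i` afterwards. Since `‖z i‖ ≤ ‖increment f i - z i‖ +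
‖increment f i‖`, the early interval adds only its length times `‖increment f i‖`. -/
theorem pathDist_codePath_le (f : StepPath E) {k : ℕ} (hk : numJumps f = k) {x₀ : E}
    (h0 : f.1 ⟨0, by norm_num⟩ = x₀) (p : Fin k → ℝ) (z : Fin k → E) {δ : ℝ}
    (hp : ∀ i : Fin k, p i ≤ jumpTime f (i + 1) ∧ jumpTime f (i + 1) ≤ p i + δ) :
    pathDist normDist f (codePath x₀ p z) ≤
      ∑ i : Fin k, (‖increment f i - z i‖ₑ + ENNReal.ofReal δ * ‖increment f i‖ₑ) := by
  have hpt : ∀ t : Set.Ico (0 : ℝ) 1, normDist (f.1 t) ((codePath x₀ p z).1 t) ≤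
      ∑ i : Fin k, (‖increment f i - z i‖ₑ +
        (Set.Ico (p i) (jumpTime f (i + 1))).indicator (fun _ => ‖increment f i‖ₑ) (t : ℝ)) := by
    intro t
    have : f.1 t - (codePath x₀ p z).1 t =
        ∑ i : Fin k, ((if jumpTime f (i + 1) ≤ t then increment f i else 0) -
          (if p i ≤ t then z i else 0)) := by
      rw [f.eq_sum_increment hk t, h0, Finset.sum_sub_distrib]
      exact add_sub_add_left_eq_sub _ _ _
    rw [normDist, this]
    refine (enorm_sum_le _ _).trans (Finset.sum_le_sum fun i _ => ?_)
    by_cases h1 : jumpTime f (i + 1) ≤ t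
    · rw [if_pos h1, if_pos ((hp i).1.trans h1)]
      exact le_self_add
    · rw [if_neg h1]
      by_cases h2 : p i ≤ t
      · rw [if_pos h2, Set.indicator_of_mem (show (t : ℝ) ∈ Set.Ico (p i) _ from ⟨h2, not_le.1 h1⟩)]
        rw [show (0 : E) - z i = (increment f i - z i) - increment f i by abel]
        exact enorm_sub_le
      · rw [if_neg h2]
        simp
  calc pathDist normDist f (codePath x₀ p z)
      ≤ ∫⁻ t : Set.Ico (0 : ℝ) 1, ∑ i : Fin k, (‖increment f i - z i‖ₑ +
        (Set.Ico (p i) (jumpTime f (i + 1))).indicator (fun _ => ‖increment f i‖ₑ) (t : ℝ))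
          ∂(Measure.comap Subtype.val volume) := lintegral_mono hpt
    _ = ∫⁻ t in Set.Ico (0 : ℝ) 1, ∑ i : Fin k, (‖increment f i - z i‖ₑ +
        (Set.Ico (p i) (jumpTime f (i + 1))).indicator (fun _ => ‖increment f i‖ₑ) t) :=
      lintegral_subtype_comap measurableSet_Ico (fun t : ℝ => ∑ i : Fin k,
        (‖increment f i - z i‖ₑ +
        (Set.Ico (p i) (jumpTime f (i + 1))).indicator (fun _ => ‖increment f i‖ₑ) t))
    _ = ∑ i : Fin k, (‖increment f i - z i‖ₑ + ∫⁻ t in Set.Ico (0 : ℝ) 1,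
        (Set.Ico (p i) (jumpTime f (i + 1))).indicator (fun _ => ‖increment f i‖ₑ) t) := by
      rw [lintegral_finsetSum]
      · refine Finset.sum_congr rfl fun i _ => ?_
        rw [lintegral_add_left measurable_const]
        simp
      · exact fun i _ => Measurable.const_add (measurable_const.indicator measurableSet_Ico) _
    _ ≤ _ := by
      refine Finset.sum_le_sum fun i _ => add_le_add le_rfl ?_
      refine (setLIntegral_le_lintegral _ _).trans ?_
      rw [lintegral_indicator measurableSet_Ico, setLIntegral_const, Real.volume_Ico, mul_comm]
      gcongr
      linarith [(hp i).2]

/-- Rounding a time in `[0,1[` down to the grid with `m` points. -/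
def gridIndex (m : ℕ) [NeZero m] (t : ℝ) : Fin m := Fin.ofNat m ⌊m * t⌋₊

theorem measurable_gridIndex (m : ℕ) [NeZero m] : Measurable (gridIndex m) :=
  (Measurable.of_discrete (f := Fin.ofNat m)).comp
    (Nat.measurable_floor.comp (measurable_const.mul measurable_id))

theorem gridIndex_le (m : ℕ) [NeZero m] {t : ℝ} (h0 : 0 ≤ t) (h1 : t < 1) :
    ((gridIndex m t : ℕ) : ℝ) / m ≤ t ∧ t ≤ ((gridIndex m t : ℕ) : ℝ) / m + (m : ℝ)⁻¹ := by
  have hm : (0 : ℝ) < m := by exact_mod_cast Nat.pos_of_ne_zero (NeZero.ne m)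
  have hlt : ⌊m * t⌋₊ < m := by
    rw [Nat.floor_lt (by positivity)]
    nlinarith
  -- `Fin.ofNat` reduces modulo `m`, which has no effect for `t` in `[0,1[`.
  have he : (gridIndex m t : ℕ) = ⌊m * t⌋₊ := by
    rw [gridIndex, Fin.val_ofNat, Nat.mod_eq_of_lt hlt]
  rw [he]
  have h2 := Nat.floor_le (show 0 ≤ m * t by positivity)
  have h3 := Nat.lt_floor_add_one (m * t)
  constructor
  · rw [div_le_iff₀ hm]; linarith
  · rw [← one_div, ← add_div, le_div_iff₀ hm]; linarith

/-- The path encoded by grid positions and codebook indices. -/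
def decodePath (x₀ : E) {m n k : ℕ} (a : Fin n → E) (c : Fin k → Fin m × Fin n) : StepPath E :=
  codePath x₀ (fun i => ((c i).1 : ℝ) / m) (fun i => a (c i).2)

/-- The code of a path: the jump positions are rounded to a grid and the increments are quantized
by `idx`. -/
def encodePath {m n : ℕ} [NeZero m] (idx : E → Fin n) (k : ℕ) (f : StepPath E) :
    Fin k → Fin m × Fin n :=
  fun i => (gridIndex m (jumpTime f (i + 1)), idx (increment f i))

theorem jumpTime_lt_one_of_numJumps {E : Type*} (f : StepPath E) {k i : ℕ} (hk : numJumps f = k)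
    (hi : i ≤ k) : jumpTime f i < 1 :=
  (jumpTime_mono f hi).trans_lt ((numJumps_eq_iff f k).1 hk).1

theorem pathDist_decodePath_le (f : StepPath E) {k : ℕ} (hk : numJumps f = k) {x₀ : E}
    (h0 : f.1 ⟨0, by norm_num⟩ = x₀) {m n : ℕ} [NeZero m] (a : Fin n → E) (idx : E → Fin n) :
    pathDist normDist f (decodePath x₀ a (encodePath (m := m) idx k f)) ≤
      ∑ i : Fin k, (‖increment f i - a (idx (increment f i))‖ₑ +
        ENNReal.ofReal (m : ℝ)⁻¹ * ‖increment f i‖ₑ) :=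
  pathDist_codePath_le f hk h0 _ _ fun i =>
    gridIndex_le m (jumpTime_nonneg f _) (jumpTime_lt_one_of_numJumps f hk i.2)

variable [MeasurableSpace E] [MeasurableSub₂ E]

theorem measurable_encodePath (hn : Measurable (fun x : E => ‖x‖)) {m n : ℕ} [NeZero m]
    {idx : E → Fin n} (hidx : Measurable idx) (k : ℕ) :
    Measurable (encodePath (m := m) idx k) :=
  measurable_pi_lambda _ fun i => ((measurable_gridIndex m).comp (measurable_jumpTime hn _)).prodMk
    (hidx.comp (measurable_increment hn i))

/-- Codebook points are added one at a time and the new point is compared with the previous winner,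
so every selection rule is a measurable case distinction. -/
theorem exists_nearest_index (hn : Measurable (fun x : E => ‖x‖)) :
    ∀ {n : ℕ} (a : Fin (n + 1) → E), ∃ idx : E → Fin (n + 1), Measurable idx ∧
      ∀ x j, ‖x - a (idx x)‖ ≤ ‖x - a j‖
  | 0, a => ⟨fun _ => 0, measurable_const, fun x j => by rw [Fin.fin_one_eq_zero j]⟩
  | n + 1, a => by
    obtain ⟨idx, hm, hle⟩ := exists_nearest_index hn (fun i => a i.castSucc)
    have hd : ∀ i, Measurable fun x => ‖x - a i‖ := fun i =>
      hn.comp (measurable_id.sub measurable_const)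
    have hd' : Measurable fun x => ‖x - a (idx x).castSucc‖ :=
      hn.comp (measurable_id.sub ((Measurable.of_discrete (f := fun i : Fin (n + 1) =>
        a i.castSucc)).comp hm))
    classical
    refine ⟨fun x => if ‖x - a (Fin.last _)‖ ≤ ‖x - a (idx x).castSucc‖ then Fin.last _
      else (idx x).castSucc, ?_, fun x j => ?_⟩
    · exact Measurable.ite (measurableSet_le (hd _) hd') measurable_const
        (Measurable.of_discrete.comp hm)
    · refine Fin.lastCases ?_ (fun j => ?_) j
      · dsimp only
        split_ifs with h
        · exact le_rfl
        · exact (not_le.1 h).le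
      · dsimp only
        split_ifs with h
        · exact h.trans (hle x j)
        · exact hle x j

end CodePaths

/-! ### Moments -/

section Moments

/-- Comparing with the largest term covers all `s > 0` at once, without separating the convex and
concave cases; only polynomial growth of the constant matters later. -/
theorem ENNReal.sum_rpow_le {ι : Type*} [Fintype ι] (a : ι → ℝ≥0∞) {s : ℝ} (hs : 0 < s) :
    (∑ i, a i) ^ s ≤ (Fintype.card ι : ℝ≥0∞) ^ s * ∑ i, a i ^ s := by
  cases isEmpty_or_nonempty ι
  · simp [hs]
  · obtain ⟨i₀, hi₀⟩ := Finite.exists_max a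
    calc (∑ i, a i) ^ s ≤ ((Fintype.card ι : ℝ≥0∞) * a i₀) ^ s := by
          gcongr
          refine (Finset.sum_le_card_nsmul _ _ _ fun i _ => hi₀ i).trans_eq ?_
          rw [nsmul_eq_mul, Finset.card_univ]
      _ = (Fintype.card ι : ℝ≥0∞) ^ s * a i₀ ^ s := ENNReal.mul_rpow_of_nonneg _ _ hs.le
      _ ≤ _ := by
          gcongr
          exact Finset.single_le_sum (f := fun i => a i ^ s) (fun _ _ => zero_le)
            (Finset.mem_univ i₀)

theorem ENNReal.sum_add_rpow_le {k : ℕ} (a b : Fin k → ℝ≥0∞) {s : ℝ} (hs : 0 < s) :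
    (∑ i, (a i + b i)) ^ s ≤ (2 * k : ℝ≥0∞) ^ s * ∑ i, (a i ^ s + b i ^ s) := by
  have h := ENNReal.sum_rpow_le (Sum.elim a b) hs
  simp only [Fintype.sum_sum_type, Sum.elim_inl, Sum.elim_inr, Fintype.card_sum,
    Fintype.card_fin, ← Finset.sum_add_distrib] at h
  convert h using 3
  push_cast
  ring

variable {Ω Ω' E : Type*} [MeasurableSpace Ω] [MeasurableSpace Ω'] [NormedAddCommGroup E]
  [MeasurableSpace E] {P : Measure Ω} {X : Ω → StepPath E} {P' : Measure Ω'} {ζ : Ω' → E}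
  {K lam s : ℝ}

theorem measurable_enorm_of_norm (hn : Measurable (fun x : E => ‖x‖)) :
    Measurable (fun x : E => ‖x‖ₑ) := by
  simp_rw [← ofReal_norm]
  exact hn.ennreal_ofReal

theorem measurableSet_numJumps [MeasurableSub₂ E] (hn : Measurable (fun x : E => ‖x‖))
    (hX : Measurable X) (k : ℕ) : MeasurableSet {ω | numJumps (X ω) = k} :=
  ((measurable_numJumps hn).comp hX) (measurableSet_singleton k)

/-- The conditional law in unnormalised form, which also covers null events and can be summed over
`k`. -/
theorem IsJumpModel.setLIntegral_increment [IsFiniteMeasure P]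
    (hM : IsJumpModel P X P' ζ K lam)
    {k i : ℕ} (hi : i < k) {h : E → ℝ≥0∞} (hh : Measurable h) :
    ∫⁻ ω in {ω | numJumps (X ω) = k}, h (increment (X ω) i) ∂P =
      P {ω | numJumps (X ω) = k} * ∫⁻ ω, h (ζ ω) ∂P' := by
  by_cases h0 : P {ω | numJumps (X ω) = k} = 0
  · rw [h0, zero_mul, Measure.restrict_eq_zero.2 h0, lintegral_zero_measure]
  · have := ((hM.incr_law k h0 i hi).comp hh).lintegral_eq
    simp only [Function.comp_def] at this
    rw [← this, ProbabilityTheory.cond, lintegral_smul_measure, smul_eq_mul, ← mul_assoc,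
      ENNReal.mul_inv_cancel h0 (measure_ne_top _ _), one_mul]

variable [MeasurableSub₂ E]

/-- The moment of the coding error on `{N_X = k}`. -/
theorem IsJumpModel.setLIntegral_pathDist_le [IsFiniteMeasure P]
    (hM : IsJumpModel P X P' ζ K lam) (hn : Measurable (fun x : E => ‖x‖)) (hs : 0 < s) {x₀ : E}
    (h0 : ∀ᵐ ω ∂P, (X ω).1 ⟨0, by norm_num⟩ = x₀) (k : ℕ) {m n : ℕ} [NeZero m]
    (a : Fin n → E) {idx : E → Fin n} (hidx : Measurable idx) :
    ∫⁻ ω in {ω | numJumps (X ω) = k}, pathDist normDist (X ω)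
        (decodePath x₀ a (encodePath (m := m) idx k (X ω))) ^ s ∂P ≤
      (2 * k : ℝ≥0∞) ^ s * k * P {ω | numJumps (X ω) = k} *
        (∫⁻ ω, ‖ζ ω - a (idx (ζ ω))‖ₑ ^ s ∂P' +
          ENNReal.ofReal (m : ℝ)⁻¹ ^ s * ∫⁻ ω, ‖ζ ω‖ₑ ^ s ∂P') := by
  have hne := measurable_enorm_of_norm hn
  have hq1 : Measurable fun x : E => ‖x - a (idx x)‖ₑ ^ s :=
    (hne.comp (measurable_id.sub ((Measurable.of_discrete (f := a)).comp hidx))).pow_const s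
  have hq2 : Measurable fun x : E => ENNReal.ofReal (m : ℝ)⁻¹ ^ s * ‖x‖ₑ ^ s :=
    (hne.pow_const s).const_mul _
  have hA := measurableSet_numJumps hn hM.measurable_path k
  have hinc : ∀ i, Measurable fun ω => increment (X ω) i := fun i =>
    (measurable_increment hn i).comp hM.measurable_path
  calc _ ≤ ∫⁻ ω in {ω | numJumps (X ω) = k}, (2 * k : ℝ≥0∞) ^ s * ∑ i : Fin k,
        (‖increment (X ω) i - a (idx (increment (X ω) i))‖ₑ ^ s +
          ENNReal.ofReal (m : ℝ)⁻¹ ^ s * ‖increment (X ω) i‖ₑ ^ s) ∂P := by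
        refine lintegral_mono_ae ?_
        filter_upwards [ae_restrict_of_ae h0, ae_restrict_mem hA] with ω hω hk
        refine (ENNReal.rpow_le_rpow (pathDist_decodePath_le (X ω) hk hω a idx) hs.le).trans ?_
        refine (ENNReal.sum_add_rpow_le _ _ hs).trans_eq ?_
        simp_rw [ENNReal.mul_rpow_of_nonneg _ _ hs.le]
    _ = (2 * k : ℝ≥0∞) ^ s * ∑ i : Fin k, (P {ω | numJumps (X ω) = k} *
        (∫⁻ ω, ‖ζ ω - a (idx (ζ ω))‖ₑ ^ s ∂P' +
          ENNReal.ofReal (m : ℝ)⁻¹ ^ s * ∫⁻ ω, ‖ζ ω‖ₑ ^ s ∂P')) := by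
        rw [lintegral_const_mul, lintegral_finsetSum]
        · congr 1
          refine Finset.sum_congr rfl fun i _ => ?_
          rw [lintegral_add_left (f := fun ω => ‖increment (X ω) i - a (idx (increment (X ω) i))‖ₑ ^ s)
              (hq1.comp (hinc i)), hM.setLIntegral_increment i.2 hq1,
            hM.setLIntegral_increment i.2 hq2, ← mul_add, lintegral_const_mul]
          exact (hne.comp hM.measurable_incr).pow_const s
        · exact fun i _ => (hq1.comp (hinc i)).add (hq2.comp (hinc i))
        · exact Finset.measurable_sum _ fun i _ => (hq1.comp (hinc i)).add (hq2.comp (hinc i))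
    _ = _ := by
        rw [Finset.sum_const, Finset.card_univ, Fintype.card_fin, nsmul_eq_mul]
        ring

theorem exists_mem_quantNumber {S : Type*} {ε : ℝ} {Y : Ω → S} {ρ : S → S → ℝ≥0∞}
    (h : quantNumber ε P Y ρ s < ⊤) : ∃ N : ℕ, 1 ≤ N ∧ N ≤ (quantNumber ε P Y ρ s).toNat ∧
      quantError (Real.log N) P Y ρ s ≤ ENNReal.ofReal ε := by
  classical
  have hex : ∃ n : ℕ, 1 ≤ n ∧ quantError (Real.log n) P Y ρ s ≤ ENNReal.ofReal ε := by
    by_contra hc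
    push Not at hc
    refine h.ne ?_
    simp only [quantNumber, iInf_eq_top]
    exact fun n h1 h2 => absurd h2 (not_le.2 (hc n h1))
  refine ⟨Nat.find hex, (Nat.find_spec hex).1, ?_, (Nat.find_spec hex).2⟩
  have hle : ((Nat.find hex : ℕ) : ℕ∞) ≤ quantNumber ε P Y ρ s := by
    refine le_iInf fun n => le_iInf fun h1 => le_iInf fun h2 => ?_
    exact_mod_cast Nat.find_min' hex ⟨h1, h2⟩
  rw [← ENat.natCast_toNat h.ne] at hle
  exact_mod_cast hle

theorem quantNumber_anti {S : Type*} {Y : Ω → S} {ρ : S → S → ℝ≥0∞} {ε ε' : ℝ} (h : ε ≤ ε') :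
    quantNumber ε' P Y ρ s ≤ quantNumber ε P Y ρ s :=
  le_iInf fun n => le_iInf fun h1 => le_iInf fun h2 =>
    iInf_le_of_le n (iInf_le_of_le h1 (iInf_le_of_le (h2.trans (ENNReal.ofReal_le_ofReal h)) le_rfl))

/-- A codebook for `ζ` with a measurable nearest point selection. -/
theorem exists_codebook (hn : Measurable (fun x : E => ‖x‖)) (hs : 0 < s) {ε : ℝ} (hε : 0 < ε)
    (h : quantNumber ε P' ζ normDist s < ⊤) :
    ∃ (n : ℕ) (a : Fin n → E) (idx : E → Fin n), 1 ≤ n ∧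
      n ≤ (quantNumber ε P' ζ normDist s).toNat ∧ Measurable idx ∧
      ∫⁻ ω, ‖ζ ω - a (idx (ζ ω))‖ₑ ^ s ∂P' ≤ ENNReal.ofReal (2 * ε) ^ s := by
  obtain ⟨N, hN1, hN2, hN3⟩ := exists_mem_quantNumber h
  -- The infimum in `quantError` need not be attained; the factor `2` leaves room for an actual
  -- codebook.
  have hlt := hN3.trans_lt ((ENNReal.ofReal_lt_ofReal_iff (by positivity)).2
    (show ε < 2 * ε by linarith))
  simp only [quantError, iInf_lt_iff] at hlt
  obtain ⟨C, hC, hcard, hlt⟩ := hlt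
  have hcN : C.card ≤ N := by
    have := (Real.log_le_log_iff (by exact_mod_cast hC.card_pos) (by exact_mod_cast hN1)).1 hcard
    exact_mod_cast this
  obtain ⟨n, hcn⟩ : ∃ n, C.card = n + 1 := Nat.exists_eq_succ_of_ne_zero hC.card_pos.ne'
  let e := C.equivFinOfCardEq hcn
  obtain ⟨idx, hidx, hle⟩ := exists_nearest_index hn (fun i => (e.symm i : E))
  refine ⟨n + 1, fun i => (e.symm i : E), idx, by omega, by omega, hidx, ?_⟩
  have h1 := (ENNReal.rpow_lt_rpow_iff hs).2 hlt
  rw [← ENNReal.rpow_mul, one_div_mul_cancel hs.ne', ENNReal.rpow_one] at h1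
  refine le_trans (lintegral_mono fun ω => le_iInf₂ fun x hx => ?_) h1.le
  have := hle (ζ ω) (e ⟨x, hx⟩)
  simp only [Equiv.symm_apply_apply] at this
  refine ENNReal.rpow_le_rpow ?_ hs.le
  rw [normDist, ← ofReal_norm, ← ofReal_norm]
  exact ENNReal.ofReal_le_ofReal this

/-- A finite codebook is bounded, so `‖ζ‖` exceeds the quantization error by at most a constant. -/
theorem moment_lt_top [IsFiniteMeasure P'] (hn : Measurable (fun x : E => ‖x‖)) (hs : 0 < s)
    {ε : ℝ} (hε : 0 < ε) (h : quantNumber ε P' ζ normDist s < ⊤) :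
    ∫⁻ ω, ‖ζ ω‖ₑ ^ s ∂P' < ⊤ := by
  obtain ⟨n, a, idx, -, -, -, hq⟩ := exists_codebook hn hs hε h
  set R : ℝ≥0∞ := ∑ i, ‖a i‖ₑ with hR
  have hRtop : R ≠ ⊤ := by simp [hR]
  have hpt : ∀ x : E, ‖x‖ₑ ^ s ≤ 2 ^ s * (‖x - a (idx x)‖ₑ ^ s + R ^ s) := by
    intro x
    have h1 : ‖x‖ₑ ≤ ‖x - a (idx x)‖ₑ + R := by
      calc ‖x‖ₑ = ‖(x - a (idx x)) + a (idx x)‖ₑ := by rw [sub_add_cancel]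
        _ ≤ ‖x - a (idx x)‖ₑ + ‖a (idx x)‖ₑ := enorm_add_le _ _
        _ ≤ _ := by
          gcongr
          exact Finset.single_le_sum (f := fun i => ‖a i‖ₑ) (fun _ _ => zero_le)
            (Finset.mem_univ (idx x))
    refine (ENNReal.rpow_le_rpow h1 hs.le).trans ?_
    simpa using ENNReal.sum_add_rpow_le (k := 1) (fun _ => ‖x - a (idx x)‖ₑ) (fun _ => R) hs
  calc ∫⁻ ω, ‖ζ ω‖ₑ ^ s ∂P' ≤ ∫⁻ ω, 2 ^ s * (‖ζ ω - a (idx (ζ ω))‖ₑ ^ s + R ^ s) ∂P' :=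
        lintegral_mono fun ω => hpt _
    _ = 2 ^ s * (∫⁻ ω, ‖ζ ω - a (idx (ζ ω))‖ₑ ^ s ∂P' + R ^ s * P' Set.univ) := by
        rw [lintegral_const_mul' _ _ (by simp), lintegral_add_right _ measurable_const,
          lintegral_const]
    _ < ⊤ := by
        refine ENNReal.mul_lt_top (ENNReal.rpow_lt_top_of_nonneg hs.le (by simp))
          (ENNReal.add_lt_top.2 ⟨hq.trans_lt ?_, ?_⟩)
        · exact ENNReal.rpow_lt_top_of_nonneg hs.le ENNReal.ofReal_ne_top
        · exact ENNReal.mul_lt_top (ENNReal.rpow_lt_top_of_nonneg hs.le hRtop)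
            (measure_lt_top _ _)

end Moments

/-! ### Entropy of coded variables -/

section Entropy

/-- One term of Gibbs' inequality, from `log x ≤ x - 1` at `x = w / p`. The summands `p` and `w` are
added rather than subtracted because of truncated subtraction; they cancel after summation. -/
theorem negMulLog_add_le {p w : ℝ} (hp : 0 ≤ p) (hp1 : p ≤ 1) (hw : 0 < w) (hw1 : w ≤ 1) :
    ENNReal.ofReal (Real.negMulLog p) + ENNReal.ofReal p ≤
      ENNReal.ofReal p * ENNReal.ofReal (-Real.log w) + ENNReal.ofReal w := by
  have hlw : 0 ≤ -Real.log w := by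
    have := Real.log_nonpos hw.le hw1
    linarith
  rcases hp.eq_or_lt with rfl | hp0
  · simp
  · rw [← ENNReal.ofReal_mul hp, ← ENNReal.ofReal_add (by positivity) hw.le]
    have key : Real.negMulLog p + p ≤ p * -Real.log w + w := by
      have h := Real.log_le_sub_one_of_pos (div_pos hw hp0)
      rw [Real.log_div hw.ne' hp0.ne'] at h
      have h2 := mul_le_mul_of_nonneg_left h hp
      have h3 : p * (w / p - 1) = w - p := by field_simp
      rw [h3] at h2
      rw [Real.negMulLog]
      nlinarith
    rw [← ENNReal.ofReal_add (Real.negMulLog_nonneg hp hp1) hp]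
    exact ENNReal.ofReal_le_ofReal key

variable {Ω S ι : Type*} [MeasurableSpace Ω] [Countable ι] {P : Measure Ω} {W : Ω → ι}

theorem measurableSet_preimage_of_countable (hW : ∀ c, MeasurableSet (W ⁻¹' {c})) (B : Set ι) :
    MeasurableSet (W ⁻¹' B) := by
  rw [← Set.biUnion_preimage_singleton]
  exact MeasurableSet.biUnion (Set.to_countable B) fun c _ => hW c

/-- Gibbs' inequality: a variable coded with (sub-)probability weights `v` has entropy at most the
expected code length. -/
theorem discreteEntropy_comp_le [IsProbabilityMeasure P]
    (hW : ∀ c, MeasurableSet (W ⁻¹' {c})) (Φ : ι → S) {v : ι → ℝ} (hv : ∀ c, 0 < v c)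
    (hsum : ∑' c, ENNReal.ofReal (v c) ≤ 1) :
    discreteEntropy P (Φ ∘ W) ≤ ∫⁻ ω, ENNReal.ofReal (-Real.log (v (W ω))) ∂P := by
  have hA : (Set.range Φ).Countable := Set.countable_range Φ
  have := hA.to_subtype
  have hmem : ∀ ω, (Φ ∘ W) ω ∈ Set.range Φ := fun ω => ⟨W ω, rfl⟩
  rw [discreteEntropy, if_pos ⟨_, hA, Eventually.of_forall hmem⟩]
  set B : S → Set Ω := fun x => (Φ ∘ W) ⁻¹' {x} with hB
  have hBm : ∀ x, MeasurableSet (B x) := fun x =>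
    measurableSet_preimage_of_countable hW (Φ ⁻¹' {x})
  have hdisj : Pairwise (Function.onFun Disjoint fun x : Set.range Φ => B x) := by
    intro x y hxy
    refine Set.disjoint_left.2 fun ω h1 h2 => hxy (Subtype.ext ?_)
    exact (Set.mem_singleton_iff.1 h1).symm.trans h2
  have hunion : ⋃ x : Set.range Φ, B x = Set.univ :=
    Set.eq_univ_of_forall fun ω => Set.mem_iUnion.2 ⟨⟨_, hmem ω⟩, rfl⟩
  have hsupp : Function.support (fun x => ENNReal.ofReal (Real.negMulLog (P.real (B x)))) ⊆
      Set.range Φ := by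
    intro x hx
    by_contra hc
    have : B x = ∅ := Set.eq_empty_of_forall_notMem fun ω hω => hc ⟨W ω, hω⟩
    refine Function.mem_support.1 hx ?_
    rw [this]
    simp
  rw [← tsum_subtype_eq_of_support_subset hsupp]
  -- Several code words may decode to `x`; merging them gives `x` their total weight, and this only
  -- shortens the code length.
  set w : S → ℝ≥0∞ := fun x => ∑' c : Φ ⁻¹' {x}, ENNReal.ofReal (v c) with hwdef
  have hwsum : ∑' x : Set.range Φ, w x ≤ 1 :=
    (ENNReal.tsum_comp_le_tsum_of_injective Subtype.val_injective w).trans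
      ((ENNReal.tsum_fiberwise _ Φ).trans_le hsum)
  have hw1 : ∀ x : Set.range Φ, w x ≤ 1 := fun x => (ENNReal.le_tsum x).trans hwsum
  have hvw : ∀ c, v c ≤ (w (Φ c)).toReal := fun c => by
    rw [← ENNReal.toReal_ofReal (hv c).le]
    refine ENNReal.toReal_mono ((hw1 ⟨Φ c, c, rfl⟩).trans_lt ENNReal.one_lt_top).ne ?_
    exact ENNReal.le_tsum (f := fun c : Φ ⁻¹' {Φ c} => ENNReal.ofReal (v c)) ⟨c, rfl⟩
  have hPsum : ∑' x : Set.range Φ, ENNReal.ofReal (P.real (B x)) = 1 := by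
    have h : ∀ x : Set.range Φ, ENNReal.ofReal (P.real (B x)) = P (B x) :=
      fun x => ofReal_measureReal
    simp_rw [h]
    rw [← measure_iUnion hdisj fun x => hBm x, hunion, measure_univ]
  have hterm : ∀ x : Set.range Φ, ENNReal.ofReal (Real.negMulLog (P.real (B x))) +
      ENNReal.ofReal (P.real (B x)) ≤
      ∫⁻ ω in B x, ENNReal.ofReal (-Real.log (v (W ω))) ∂P + w x := by
    rintro ⟨x, c, rfl⟩
    have hw0 := (hv c).trans_le (hvw c)
    have hle1 : (w (Φ c)).toReal ≤ 1 :=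
      ENNReal.toReal_le_of_le_ofReal zero_le_one (by simpa using hw1 ⟨Φ c, c, rfl⟩)
    refine (negMulLog_add_le measureReal_nonneg measureReal_le_one hw0 hle1).trans ?_
    rw [ENNReal.ofReal_toReal ((hw1 ⟨Φ c, c, rfl⟩).trans_lt ENNReal.one_lt_top).ne]
    refine add_le_add ?_ le_rfl
    rw [ofReal_measureReal, mul_comm, ← setLIntegral_const]
    refine setLIntegral_mono' (hBm _) fun ω hω => ENNReal.ofReal_le_ofReal (neg_le_neg ?_)
    have hω' : Φ (W ω) = Φ c := hω
    exact Real.log_le_log (hv _) (hω' ▸ hvw (W ω))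
  have htot := ENNReal.tsum_le_tsum hterm
  rw [ENNReal.tsum_add, ENNReal.tsum_add, hPsum, ← lintegral_iUnion (fun x : Set.range Φ => hBm x) hdisj, hunion,
    Measure.restrict_univ] at htot
  exact (ENNReal.add_le_add_iff_right ENNReal.one_ne_top).1 (htot.trans (by gcongr))

end Entropy

/-! ### Moments of the jump count and entropy of the path code -/

section CountMoments

/-- The bound for `P(N_X = k)`. -/
def poissonBound (K lam : ℝ) (k : ℕ) : ℝ := lam ^ k / (k.factorial : ℝ) * Real.exp (-lam) * K

theorem hasSum_mul_poissonBound (K lam : ℝ) :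
    HasSum (fun k : ℕ => (k : ℝ) * poissonBound K lam k) (K * lam) := by
  rw [← hasSum_nat_add_iff' 1]
  have h := (NormedSpace.expSeries_div_hasSum_exp (𝔸 := ℝ) lam).mul_left
    (K * lam * Real.exp (-lam))
  rw [← Real.exp_eq_exp_ℝ, mul_assoc (K * lam), ← Real.exp_add, neg_add_cancel, Real.exp_zero,
    mul_one] at h
  simp only [Finset.range_one, Finset.sum_singleton, Nat.cast_zero, zero_mul, sub_zero]
  refine h.congr_fun fun k => ?_
  rw [poissonBound, Nat.factorial_succ]
  push_cast
  field_simp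
  ring

variable {Ω Ω' E : Type*} [MeasurableSpace Ω] [MeasurableSpace Ω'] [NormedAddCommGroup E]
  [MeasurableSpace E] {P : Measure Ω} {X : Ω → StepPath E} {P' : Measure Ω'} {ζ : Ω' → E}
  {K lam s : ℝ}

theorem IsJumpModel.poissonBound_nonneg (hM : IsJumpModel P X P' ζ K lam) (k : ℕ) :
    0 ≤ poissonBound K lam k := by
  have := hM.lam_pos
  have := hM.one_le_K
  unfold poissonBound
  positivity

theorem IsJumpModel.measure_numJumps_le [IsFiniteMeasure P] (hM : IsJumpModel P X P' ζ K lam)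
    (k : ℕ) : P {ω | numJumps (X ω) = k} ≤ ENNReal.ofReal (poissonBound K lam k) := by
  rw [← ofReal_measureReal]
  exact ENNReal.ofReal_le_ofReal (hM.count_le k)

/-- Subadditivity over a countable cover, which needs measurability neither of the integrand nor of
the events. -/
theorem lintegral_le_tsum_numJumps {E : Type*} {X : Ω → StepPath E} (f : Ω → ℝ≥0∞) :
    ∫⁻ ω, f ω ∂P ≤ ∑' k, ∫⁻ ω in {ω | numJumps (X ω) = k}, f ω ∂P := by
  have : ⋃ k, {ω | numJumps (X ω) = k} = Set.univ :=
    Set.eq_univ_of_forall fun ω => Set.mem_iUnion.2 ⟨_, rfl⟩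
  rw [← setLIntegral_univ, ← this]
  exact lintegral_iUnion_le _ _

variable [MeasurableSub₂ E]

theorem IsJumpModel.lintegral_numJumps_le [IsFiniteMeasure P] (hM : IsJumpModel P X P' ζ K lam)
    (hn : Measurable (fun x : E => ‖x‖)) :
    ∫⁻ ω, (numJumps (X ω) : ℝ≥0∞) ∂P ≤ ENNReal.ofReal (K * lam) := by
  refine (lintegral_le_tsum_numJumps (X := X) _).trans ?_
  rw [← (hasSum_mul_poissonBound K lam).tsum_eq, ENNReal.ofReal_tsum_of_nonneg
    (fun k => mul_nonneg k.cast_nonneg (hM.poissonBound_nonneg k))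
    (hasSum_mul_poissonBound K lam).summable]
  refine ENNReal.tsum_le_tsum fun k => ?_
  rw [setLIntegral_congr_fun (g := fun _ => (k : ℝ≥0∞))
    (measurableSet_numJumps hn hM.measurable_path k) (fun ω hω => by
      have : numJumps (X ω) = k := hω
      simp only [this]), setLIntegral_const, ENNReal.ofReal_mul k.cast_nonneg,
    ENNReal.ofReal_natCast]
  gcongr
  exact hM.measure_numJumps_le k

/-- The complete code of the path `X ω`. -/
def codeOf {m n : ℕ} [NeZero m] (idx : E → Fin n) (f : StepPath E) :
    Σ k : ℕ, Fin k → Fin m × Fin n :=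
  ⟨numJumps f, encodePath idx (numJumps f) f⟩

theorem measurableSet_codeOf (hX : Measurable X) (hn : Measurable (fun x : E => ‖x‖))
    {m n : ℕ} [NeZero m] {idx : E → Fin n} (hidx : Measurable idx)
    (c : Σ k : ℕ, Fin k → Fin m × Fin n) :
    MeasurableSet ((fun ω => codeOf idx (X ω)) ⁻¹' {c}) := by
  obtain ⟨k, c⟩ := c
  have : (fun ω => codeOf idx (X ω)) ⁻¹' {(⟨k, c⟩ : Σ k : ℕ, Fin k → Fin m × Fin n)} =
      {ω | numJumps (X ω) = k} ∩ (fun ω => encodePath idx k (X ω)) ⁻¹' {c} := by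
    ext ω
    simp only [Set.mem_preimage, Set.mem_singleton_iff, Set.mem_inter_iff, Set.mem_ofPred_eq, codeOf]
    constructor
    · intro h
      obtain ⟨h1, h2⟩ := Sigma.mk.inj_iff.1 h
      subst h1
      exact ⟨rfl, eq_of_heq h2⟩
    · rintro ⟨rfl, h⟩
      rw [h]
  rw [this]
  exact (measurableSet_numJumps hn hX k).inter
    (((measurable_encodePath hn hidx k).comp hX) (measurableSet_singleton c))

/-- The entropy of the coded path. -/
theorem IsJumpModel.discreteEntropy_code_le [IsProbabilityMeasure P]
    (hM : IsJumpModel P X P' ζ K lam) (hn : Measurable (fun x : E => ‖x‖)) {S : Type*}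
    {m n : ℕ} [NeZero m] [NeZero n] {idx : E → Fin n} (hidx : Measurable idx)
    (Φ : (Σ k : ℕ, Fin k → Fin m × Fin n) → S) :
    discreteEntropy P (fun ω => Φ (codeOf idx (X ω))) ≤
      ENNReal.ofReal (K * lam * (Real.log m + Real.log n + Real.log 2) + Real.log 2) := by
  have hm : (1 : ℝ) ≤ m := by exact_mod_cast Nat.one_le_iff_ne_zero.2 (NeZero.ne m)
  have hn' : (1 : ℝ) ≤ n := by exact_mod_cast Nat.one_le_iff_ne_zero.2 (NeZero.ne n)
  have hlm := Real.log_nonneg hm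
  have hln := Real.log_nonneg hn'
  have hl2 := Real.log_nonneg one_le_two
  -- The jump count `k` gets weight `2^{-(k+1)}`, shared equally among the `(mn)^k` codes with `k`
  -- jumps.
  set v : (Σ k : ℕ, Fin k → Fin m × Fin n) → ℝ :=
    fun c => (1 / 2) ^ (c.1 + 1) * ((m * n : ℝ) ^ c.1)⁻¹ with hv
  have hv0 : ∀ c, 0 < v c := fun c => by positivity
  have hvsum : ∑' c, ENNReal.ofReal (v c) ≤ 1 := by
    rw [ENNReal.tsum_sigma']
    have : ∀ k : ℕ, ∑' c : Fin k → Fin m × Fin n, ENNReal.ofReal (v ⟨k, c⟩) =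
        ENNReal.ofReal ((1 / 2) ^ k / 2) := by
      intro k
      simp only [hv]
      rw [tsum_fintype, Finset.sum_const, Finset.card_univ, Fintype.card_fun, Fintype.card_prod,
        Fintype.card_fin, Fintype.card_fin, Fintype.card_fin, ← ENNReal.ofReal_nsmul]
      congr 1
      rw [nsmul_eq_mul]
      push_cast
      field_simp
      ring
    simp_rw [this]
    have h2 := hasSum_geometric_two.div_const 2
    rw [← ENNReal.ofReal_tsum_of_nonneg (fun k => by positivity) h2.summable, h2.tsum_eq]
    simp
  refine (discreteEntropy_comp_le (P := P) (W := fun ω => codeOf idx (X ω))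
    (measurableSet_codeOf hM.measurable_path hn hidx) Φ hv0 hvsum).trans ?_
  have hlen : ∀ ω, ENNReal.ofReal (-Real.log (v (codeOf idx (X ω)))) =
      ENNReal.ofReal (Real.log m + Real.log n + Real.log 2) * (numJumps (X ω) : ℝ≥0∞) +
        ENNReal.ofReal (Real.log 2) := by
    intro ω
    rw [← ENNReal.ofReal_natCast, ← ENNReal.ofReal_mul (by positivity),
      ← ENNReal.ofReal_add (by positivity) hl2]
    congr 1
    have : (codeOf (m := m) idx (X ω)).1 = numJumps (X ω) := rfl
    rw [hv]
    simp only [this]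
    rw [Real.log_mul (by positivity) (by positivity), Real.log_inv, Real.log_pow, Real.log_pow,
      Real.log_mul (by positivity) (by positivity), one_div, Real.log_inv]
    push_cast
    ring
  simp_rw [hlen]
  have hKl : 0 ≤ K * lam := mul_nonneg (zero_le_one.trans hM.one_le_K) hM.lam_pos.le
  rw [lintegral_add_right _ measurable_const, lintegral_const_mul' _ _ ENNReal.ofReal_ne_top,
    lintegral_const, measure_univ, mul_one, mul_comm (K * lam),
    ENNReal.ofReal_add (p := (Real.log m + Real.log n + Real.log 2) * (K * lam)) (by positivity) hl2,
    ENNReal.ofReal_mul (p := Real.log m + Real.log n + Real.log 2) (by positivity)]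
  gcongr
  exact hM.lintegral_numJumps_le hn

end CountMoments

/-! ### Entropy coding of jump processes -/

section EntropyCoding

theorem tsum_geometric_moment_lt_top (s : ℝ) :
    ∑' k : ℕ, (2 * k : ℝ≥0∞) ^ s * k * ENNReal.ofReal ((1 / 2) ^ k) < ⊤ := by
  -- An integer exponent `p ≥ s` dominates, since `2k ≥ 1` for `k ≥ 1`.
  obtain ⟨p, hs⟩ := exists_nat_ge s
  have hsum : Summable fun k : ℕ => 2 ^ p * ((k : ℝ) ^ (p + 1) * (1 / 2) ^ k) := by
    have h : ‖(1 / 2 : ℝ)‖ < 1 := by rw [Real.norm_eq_abs, abs_of_pos] <;> norm_num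
    exact Summable.mul_left (2 ^ p : ℝ)
      (summable_pow_mul_geometric_of_norm_lt_one (R := ℝ) (p + 1) h)
  have hterm : ∀ k : ℕ, (2 * k : ℝ≥0∞) ^ s * k * ENNReal.ofReal ((1 / 2) ^ k) ≤
      ENNReal.ofReal (2 ^ p * ((k : ℝ) ^ (p + 1) * (1 / 2) ^ k)) := fun k => by
    rcases Nat.eq_zero_or_pos k with rfl | hk
    · simp only [Nat.cast_zero, mul_zero, zero_mul, zero_le]
    have h1 : (1 : ℝ≥0∞) ≤ 2 * k := by
      have : 1 ≤ 2 * k := by omega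
      exact_mod_cast this
    have h2 : (2 * k : ℝ≥0∞) ^ s ≤ (2 * k : ℝ≥0∞) ^ p := by
      rw [← ENNReal.rpow_natCast]
      exact ENNReal.rpow_le_rpow_of_exponent_le h1 hs
    have h3 : (2 * k : ℝ≥0∞) = ENNReal.ofReal (2 * k) := by
      rw [ENNReal.ofReal_mul zero_le_two, ENNReal.ofReal_natCast, ENNReal.ofReal_ofNat]
    calc (2 * k : ℝ≥0∞) ^ s * k * ENNReal.ofReal ((1 / 2) ^ k)
        ≤ (2 * k : ℝ≥0∞) ^ p * k * ENNReal.ofReal ((1 / 2) ^ k) := by gcongr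
      _ = ENNReal.ofReal ((2 * k) ^ p * k * (1 / 2) ^ k) := by
          rw [h3, ← ENNReal.ofReal_pow (by positivity), ← ENNReal.ofReal_natCast k,
            ← ENNReal.ofReal_mul (by positivity), ← ENNReal.ofReal_mul (by positivity)]
      _ = _ := by
          congr 1
          ring
  exact (ENNReal.tsum_le_tsum hterm).trans_lt hsum.tsum_ofReal_lt_top

/-- A grid with at most `e ^ u` points and mesh at most `2 e ^ (-u)`. -/
theorem exists_grid_size {u : ℝ} (hu : 0 ≤ u) :
    ∃ m : ℕ, m ≠ 0 ∧ Real.log m ≤ u ∧ (m : ℝ)⁻¹ ≤ 2 * Real.exp (-u) := by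
  have hm1 : 1 ≤ ⌊Real.exp u⌋₊ := Nat.le_floor (by rw [Nat.cast_one]; exact Real.one_le_exp hu)
  have hm0 : (1 : ℝ) ≤ ⌊Real.exp u⌋₊ := by exact_mod_cast hm1
  have hmge := Nat.lt_floor_add_one (Real.exp u)
  refine ⟨⌊Real.exp u⌋₊, by omega, ?_, ?_⟩
  · exact (Real.log_le_iff_le_exp (by linarith)).2 (Nat.floor_le (Real.exp_pos _).le)
  · rw [inv_le_iff_one_le_mul₀ (by linarith), Real.exp_neg, mul_assoc, mul_left_comm,
      ← div_eq_inv_mul, le_div_iff₀ (Real.exp_pos _)]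
    linarith

/-- The moment of the Poisson bound that governs the coding error. -/
def poissonMoment (s K lam : ℝ) : ℝ≥0∞ :=
  ∑' k : ℕ, (2 * k : ℝ≥0∞) ^ s * k * ENNReal.ofReal (poissonBound K lam k)

/-- Writing `lam^k / k! = 2^{-k} (2 lam)^k / k!` and bounding the last factor by `e^{2 lam}` reduces
to a geometric series. -/
theorem poissonMoment_lt_top (s : ℝ) {K lam : ℝ} (hK : 0 ≤ K) (hlam : 0 ≤ lam) :
    poissonMoment s K lam < ⊤ := by
  have hle : ∀ k, poissonBound K lam k ≤ (1 / 2) ^ k * (Real.exp lam * K) := fun k => by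
    have h := Real.pow_div_factorial_le_exp (2 * lam) (by positivity) k
    have h2 : lam ^ k / (k.factorial : ℝ) = (1 / 2) ^ k * ((2 * lam) ^ k / k.factorial) := by
      rw [mul_pow, one_div, inv_pow]
      field_simp
    rw [poissonBound, h2]
    calc (1 / 2) ^ k * ((2 * lam) ^ k / k.factorial) * Real.exp (-lam) * K
        ≤ (1 / 2) ^ k * Real.exp (2 * lam) * Real.exp (-lam) * K := by gcongr
      _ = _ := by
        rw [mul_assoc ((1 / 2 : ℝ) ^ k), ← Real.exp_add, show 2 * lam + -lam = lam by ring]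
        ring
  refine lt_of_le_of_lt (ENNReal.tsum_le_tsum (g := fun k : ℕ => (2 * k : ℝ≥0∞) ^ s * k *
    ENNReal.ofReal ((1 / 2) ^ k) * ENNReal.ofReal (Real.exp lam * K)) fun k => ?_) ?_
  · rw [mul_assoc ((2 * k : ℝ≥0∞) ^ s * k), ← ENNReal.ofReal_mul (by positivity)]
    gcongr
    exact hle k
  · rw [ENNReal.tsum_mul_right]
    exact ENNReal.mul_lt_top (tsum_geometric_moment_lt_top s) ENNReal.ofReal_lt_top

variable {Ω Ω' E : Type*} [MeasurableSpace Ω] [MeasurableSpace Ω'] [NormedAddCommGroup E]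
  [MeasurableSpace E] [MeasurableSub₂ E] {P : Measure Ω} {X : Ω → StepPath E} {P' : Measure Ω'}
  {ζ : Ω' → E} {K lam s : ℝ}

theorem IsJumpModel.lintegral_code_le [IsFiniteMeasure P]
    (hM : IsJumpModel P X P' ζ K lam) (hn : Measurable (fun x : E => ‖x‖)) (hs : 0 < s) {x₀ : E}
    (h0 : ∀ᵐ ω ∂P, (X ω).1 ⟨0, by norm_num⟩ = x₀) {m n : ℕ} [NeZero m]
    (a : Fin n → E) {idx : E → Fin n} (hidx : Measurable idx) :
    ∫⁻ ω, pathDist normDist (X ω)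
        (decodePath x₀ a (codeOf (m := m) idx (X ω)).2) ^ s ∂P ≤
      poissonMoment s K lam *
        (∫⁻ ω, ‖ζ ω - a (idx (ζ ω))‖ₑ ^ s ∂P' +
          ENNReal.ofReal (m : ℝ)⁻¹ ^ s * ∫⁻ ω, ‖ζ ω‖ₑ ^ s ∂P') := by
  refine (lintegral_le_tsum_numJumps (X := X) _).trans ?_
  rw [poissonMoment, ← ENNReal.tsum_mul_right]
  refine ENNReal.tsum_le_tsum fun k => ?_
  rw [setLIntegral_congr_fun (g := fun ω => pathDist normDist (X ω)
        (decodePath x₀ a (encodePath (m := m) idx k (X ω))) ^ s)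
    (measurableSet_numJumps hn hM.measurable_path k) (fun ω hω => by
      have : numJumps (X ω) = k := hω
      subst this
      rfl)]
  refine (hM.setLIntegral_pathDist_le hn hs h0 k a hidx).trans ?_
  gcongr
  exact hM.measure_numJumps_le k

/-- The constant of the entropy coding bound, before taking the `s`-th root. -/
def entropyConst (s K lam : ℝ) (M : ℝ≥0∞) : ℝ≥0∞ :=
  poissonMoment s K lam * ((2 + 2 ^ s) *
    (1 + ENNReal.ofReal (Real.exp (Real.log 2 + Real.log 2 / (K * lam))) ^ s * M))

/-- The rate must be met exactly, without an additive constant. Taking `log m ≤ r - c` with `c = log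
2 + log 2 / (K lam)` cancels the overhead `K lam log 2 + log 2` of the code and enlarges the mesh
only by the factor `e^c`. -/
theorem IsJumpModel.entropyError_pow_le [IsProbabilityMeasure P] [IsProbabilityMeasure P']
    (hM : IsJumpModel P X P' ζ K lam) (hn : Measurable (fun x : E => ‖x‖)) (hs : 0 < s)
    {r : ℝ} (hr : 0 ≤ r) (hq : quantNumber (Real.exp (-r)) P' ζ normDist s < ⊤) :
    entropyError (K * (lam * r +
        lam * Real.log ((quantNumber (Real.exp (-r)) P' ζ normDist s).toNat : ℝ)))
      P X (pathDist normDist) s ≤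
    (ENNReal.ofReal (Real.exp (-r)) ^ s *
      entropyConst s K lam (∫⁻ ω, ‖ζ ω‖ₑ ^ s ∂P')) ^ (1 / s) := by
  obtain ⟨x₀, h0⟩ := hM.start
  have hlam := hM.lam_pos
  have hK := hM.one_le_K
  have hKl : 0 < K * lam := by positivity
  set c := Real.log 2 + Real.log 2 / (K * lam) with hc
  set M := ∫⁻ ω, ‖ζ ω‖ₑ ^ s ∂P' with hMdef
  set d := (quantNumber (Real.exp (-r)) P' ζ normDist s).toNat with hd
  have hcode : ∀ (m n : ℕ) [NeZero m] [NeZero n] (a : Fin n → E) (idx : E → Fin n),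
      Measurable idx → discreteEntropy P
        (fun ω => decodePath x₀ a (codeOf (m := m) idx (X ω)).2) ≤
          ENNReal.ofReal (K * (lam * r + lam * Real.log d)) →
      ∫⁻ ω, ‖ζ ω - a (idx (ζ ω))‖ₑ ^ s ∂P' + ENNReal.ofReal (m : ℝ)⁻¹ ^ s * M ≤
        ENNReal.ofReal (Real.exp (-r)) ^ s * ((2 + 2 ^ s) * (1 + ENNReal.ofReal (Real.exp c) ^ s * M)) →
      entropyError (K * (lam * r + lam * Real.log d)) P X (pathDist normDist) s ≤
        (ENNReal.ofReal (Real.exp (-r)) ^ s * entropyConst s K lam M) ^ (1 / s) := by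
    intro m n _ _ a idx hidx hent herr
    refine iInf_le_of_le (fun ω => decodePath x₀ a (codeOf (m := m) idx (X ω)).2)
      (iInf_le_of_le ?_ (iInf_le_of_le ?_ ?_))
    · exact fun B _ => measurableSet_preimage_of_countable
        (measurableSet_codeOf hM.measurable_path hn hidx)
        ((fun c : Σ k : ℕ, Fin k → Fin m × Fin n => decodePath x₀ a c.2) ⁻¹' B)
    · have hb : 0 ≤ K * (lam * r + lam * Real.log d) := by
        have := Real.log_natCast_nonneg d
        positivity
      refine (EReal.coe_ennreal_le_coe_ennreal_iff.2 hent).trans_eq ?_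
      rw [EReal.coe_ennreal_ofReal, max_eq_left hb]
    · refine ENNReal.rpow_le_rpow ((hM.lintegral_code_le hn hs h0 a hidx).trans ?_) (by positivity)
      rw [entropyConst, mul_left_comm]
      gcongr
  rcases le_or_gt c r with hcr | hcr
  · obtain ⟨n, a, idx, hn1, hnd, hidx, herr⟩ := exists_codebook hn hs (Real.exp_pos (-r)) hq
    obtain ⟨m, hm0, h1, hmesh⟩ := exists_grid_size (sub_nonneg.2 hcr)
    have : NeZero m := ⟨hm0⟩
    have : NeZero n := ⟨by omega⟩
    refine hcode m n a idx hidx ?_ ?_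
    · refine (hM.discreteEntropy_code_le hn hidx (fun c => decodePath x₀ a c.2)).trans
        (ENNReal.ofReal_le_ofReal ?_)
      have h2 : Real.log n ≤ Real.log d :=
        Real.log_le_log (by exact_mod_cast hn1) (by exact_mod_cast hnd)
      calc K * lam * (Real.log m + Real.log n + Real.log 2) + Real.log 2
          ≤ K * lam * ((r - c) + Real.log d + Real.log 2) + Real.log 2 := by gcongr
        _ = _ := by
          rw [hc]
          field_simp
          ring
    · have h3 : (m : ℝ)⁻¹ ≤ Real.exp (-r) * (2 * Real.exp c) := by
        refine hmesh.trans_eq ?_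
        rw [mul_left_comm, ← Real.exp_add, neg_sub, neg_add_eq_sub]
      calc _ ≤ ENNReal.ofReal (2 * Real.exp (-r)) ^ s +
            ENNReal.ofReal (Real.exp (-r) * (2 * Real.exp c)) ^ s * M := by gcongr
        _ = ENNReal.ofReal (Real.exp (-r)) ^ s * (2 ^ s * (1 + ENNReal.ofReal (Real.exp c) ^ s * M)) := by
          rw [ENNReal.ofReal_mul (by positivity), ENNReal.ofReal_mul (by positivity),
            ENNReal.ofReal_mul (by positivity), ENNReal.mul_rpow_of_nonneg _ _ hs.le,
            ENNReal.mul_rpow_of_nonneg _ _ hs.le, ENNReal.mul_rpow_of_nonneg _ _ hs.le,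
            ENNReal.ofReal_ofNat]
          ring
        _ ≤ _ := by
          gcongr
          exact le_add_self
  -- For `r < c` no grid is affordable. The constant path has entropy `0`, and its error is of the
  -- required order since `e^{-r} e^c ≥ 1`.
  · refine hcode 1 1 (fun _ => 0) (fun _ => 0) measurable_const ?_ ?_
    · have hconst : ∀ ω, decodePath x₀ (fun _ => 0) (codeOf (m := 1) (n := 1) (fun _ => 0) (X ω)).2 =
          codePath x₀ (fun _ : Fin 0 => 0) (fun _ => 0) := fun ω => codePath_zero x₀ _ _
      simp_rw [hconst]
      rw [discreteEntropy, if_pos ⟨{codePath x₀ (fun _ : Fin 0 => 0) (fun _ => 0)},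
        Set.countable_singleton _, Eventually.of_forall fun _ => rfl⟩]
      refine le_of_eq_of_le (ENNReal.tsum_eq_zero.2 fun x => ?_) zero_le
      by_cases hx : codePath x₀ (fun _ : Fin 0 => 0) (fun _ => 0) = x
      · simp [hx]
      · simp [hx]
    · simp only [sub_zero, Nat.cast_one, inv_one, ENNReal.ofReal_one, ENNReal.one_rpow, one_mul]
      rw [← hMdef]
      have h1 : 1 ≤ ENNReal.ofReal (Real.exp (-r)) ^ s * ENNReal.ofReal (Real.exp c) ^ s := by
        rw [← ENNReal.mul_rpow_of_nonneg _ _ hs.le, ← ENNReal.ofReal_mul (Real.exp_pos _).le,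
          ← Real.exp_add]
        refine ENNReal.one_le_rpow ?_ hs
        rw [ENNReal.one_le_ofReal]
        exact Real.one_le_exp (by linarith)
      calc M + M = 2 * (1 * M) := by ring
        _ ≤ 2 * ((ENNReal.ofReal (Real.exp (-r)) ^ s * ENNReal.ofReal (Real.exp c) ^ s) * M) := by
          gcongr
        _ = ENNReal.ofReal (Real.exp (-r)) ^ s * (2 * (ENNReal.ofReal (Real.exp c) ^ s * M)) := by ring
        _ ≤ _ := by
          gcongr
          · exact le_self_add
          · exact le_add_self

/-- The `+ 1` keeps the constant positive for all parameters, including those where `toReal` sends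
`⊤` to `0`; here the constant is finite by `moment_lt_top`. -/
theorem IsJumpModel.entropyError_le [IsProbabilityMeasure P] [IsProbabilityMeasure P']
    (hM : IsJumpModel P X P' ζ K lam) (hn : Measurable (fun x : E => ‖x‖)) (hs : 0 < s)
    {r : ℝ} (hr : 0 ≤ r) (hq : quantNumber (Real.exp (-r)) P' ζ normDist s < ⊤) :
    entropyError (K * (lam * r +
        lam * Real.log ((quantNumber (Real.exp (-r)) P' ζ normDist s).toNat : ℝ)))
      P X (pathDist normDist) s ≤
    ENNReal.ofReal (((entropyConst s K lam (∫⁻ ω, ‖ζ ω‖ₑ ^ s ∂P') ^ (1 / s)).toReal + 1) *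
      Real.exp (-r)) := by
  refine (hM.entropyError_pow_le hn hs hr hq).trans ?_
  have hfin : entropyConst s K lam (∫⁻ ω, ‖ζ ω‖ₑ ^ s ∂P') ≠ ⊤ := by
    refine (ENNReal.mul_lt_top (poissonMoment_lt_top s (zero_le_one.trans hM.one_le_K)
      hM.lam_pos.le) (ENNReal.mul_lt_top ?_ ?_)).ne
    · exact ENNReal.add_lt_top.2 ⟨by simp, ENNReal.rpow_lt_top_of_nonneg hs.le (by simp)⟩
    · exact ENNReal.add_lt_top.2 ⟨by simp, ENNReal.mul_lt_top
        (ENNReal.rpow_lt_top_of_nonneg hs.le (by simp)) (moment_lt_top hn hs (Real.exp_pos _) hq)⟩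
  rw [ENNReal.mul_rpow_of_nonneg _ _ (by positivity), ← ENNReal.rpow_mul, mul_one_div_cancel hs.ne',
    ENNReal.rpow_one, ENNReal.ofReal_mul (by positivity), mul_comm]
  gcongr
  rw [ENNReal.ofReal_add ENNReal.toReal_nonneg zero_le_one, ENNReal.ofReal_toReal]
  · exact le_self_add
  · exact ENNReal.rpow_ne_top_of_nonneg (by positivity) hfin

end EntropyCoding

/-! ### Rate allocation -/

section RateAllocation

/-- The logarithm of `k! / (2 lam) ^ k`. -/
def logWeight (lam : ℝ) (k : ℕ) : ℝ := Real.log (k.factorial / (2 * lam) ^ k)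

variable {lam : ℝ}

/-- The elementary Stirling bound `k! ≥ (k/e)^k`, read off from the exponential series. -/
theorem exists_mul_log_le_logWeight (hlam : 0 < lam) :
    ∃ c, ∀ k : ℕ, (k : ℝ) * (Real.log k - c) ≤ logWeight lam k := by
  refine ⟨1 + Real.log (2 * lam), fun k => ?_⟩
  have hfac : (0 : ℝ) < k.factorial := by exact_mod_cast k.factorial_pos
  rw [logWeight, Real.log_div hfac.ne' (by positivity), Real.log_pow]
  rcases Nat.eq_zero_or_pos k with rfl | hk
  · simp
  have hk' : (0 : ℝ) < k := by exact_mod_cast hk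
  have h := Real.pow_div_factorial_le_exp (k : ℝ) hk'.le k
  have h2 := Real.log_le_log (by positivity) h
  rw [Real.log_exp, Real.log_div (by positivity) hfac.ne', Real.log_pow] at h2
  linarith

/-- Linear growth limits to `O(D)` the jump counts that deserve a nontrivial codebook. It follows
from the tangent inequality for `log` at `e^{1+c} / k`. -/
theorem exists_sub_le_logWeight (hlam : 0 < lam) :
    ∃ c, 0 ≤ c ∧ ∀ k : ℕ, (k : ℝ) - c ≤ logWeight lam k := by
  obtain ⟨c, hc⟩ := exists_mul_log_le_logWeight hlam
  refine ⟨Real.exp (1 + c), (Real.exp_pos _).le, fun k => le_trans ?_ (hc k)⟩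
  rcases Nat.eq_zero_or_pos k with rfl | hk
  · simpa using (Real.exp_pos _).le
  have hk' : (0 : ℝ) < k := by exact_mod_cast hk
  have h := Real.log_le_sub_one_of_pos (div_pos (Real.exp_pos (1 + c)) hk')
  rw [Real.log_div (Real.exp_pos _).ne' hk'.ne', Real.log_exp] at h
  have h2 := mul_le_mul_of_nonneg_left h hk'.le
  have h3 : (k : ℝ) * (Real.exp (1 + c) / k - 1) = Real.exp (1 + c) - k := by field_simp
  rw [h3] at h2
  nlinarith

/-- The codebook for `k` jumps of optimal accuracy has negligibly more than
`exp (s Γ D² / (4 log D))` elements. -/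
theorem eventually_rate_le (hlam : 0 < lam) {s Γ c₁ p : ℝ} (hs : 0 < s) (hΓ : 0 < Γ)
    (hp0 : 0 < p) (hp1 : p < 1) :
    ∀ᶠ D : ℝ in atTop, ∀ k : ℕ, k * (c₁ + Γ * (D - logWeight lam k / s)) ≤
      s * Γ * D ^ 2 / (4 * p ^ 4 * Real.log D) := by
  obtain ⟨c₂, hc₂⟩ := exists_mul_log_le_logWeight hlam
  obtain ⟨c₃, hc₃0, hc₃⟩ := exists_sub_le_logWeight hlam
  have hlit := (isLittleO_log_rpow_atTop (r := 1 - p) (by linarith)).bound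
    (show 0 < s / (8 * p ^ 4) by positivity)
  have hlog1 : ∀ᶠ D : ℝ in atTop, c₂ / (p - p ^ 2) ≤ Real.log D :=
    Real.tendsto_log_atTop.eventually_ge_atTop _
  filter_upwards [hlit, hlog1, eventually_gt_atTop 1,
    eventually_ge_atTop (c₁ / (Γ * (1 / p - 1))), eventually_ge_atTop ((c₁ + Γ * c₃ / s) / Γ)]
    with D h1 h2 hD1 h3 h4 k
  have hpp : 0 < p - p ^ 2 := by nlinarith
  have hp' : 0 < 1 / p - 1 := by rw [sub_pos, lt_div_iff₀ hp0]; linarith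
  rw [div_le_iff₀ hpp] at h2
  rw [div_le_iff₀ (by positivity)] at h3
  rw [div_le_iff₀ hΓ] at h4
  have hD0 : 0 < D := by linarith
  have hlD : 0 < Real.log D := Real.log_pos hD1
  rw [Real.norm_of_nonneg hlD.le, Real.norm_of_nonneg (by positivity)] at h1
  rw [le_div_iff₀ (by positivity)]
  -- For `k ≥ D^p` one has `log k ≥ p log D` and a quadratic in `k` remains. For smaller `k` the
  -- crude bound `2Γ D^{1+p}` is already `o(D² / log D)`.
  rcases le_or_gt (D ^ p) (k : ℝ) with hk | hk
  · have hDp : 0 < D ^ p := Real.rpow_pos_of_pos hD0 p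
    have hk0 : (0 : ℝ) < k := hDp.trans_le hk
    have hlk : p * Real.log D ≤ Real.log k := by
      rw [← Real.log_rpow hD0]
      exact Real.log_le_log hDp hk
    have hw : k * (p ^ 2 * Real.log D) ≤ logWeight lam k := by
      refine le_trans ?_ (hc₂ k)
      gcongr
      nlinarith
    have hlin : c₁ + Γ * D ≤ Γ * D / p := by
      have : Γ * D / p = Γ * D + D * (Γ * (1 / p - 1)) := by field_simp; ring
      linarith
    set A := p ^ 2 * Real.log D with hA
    have hA0 : 0 < A := by positivity
    have hwt : c₁ + Γ * (D - logWeight lam k / s) ≤ Γ * D / p - Γ * (k * A / s) := by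
      have : k * A / s ≤ logWeight lam k / s := by gcongr
      nlinarith
    calc k * (c₁ + Γ * (D - logWeight lam k / s)) * (4 * p ^ 4 * Real.log D)
        ≤ k * (Γ * D / p - Γ * (k * A / s)) * (4 * p ^ 4 * Real.log D) := by gcongr
      -- Completing the square maximises over `k`. The factor `p^4` combines `p²` from `A` with the
      -- square of `D / p`.
      _ = s * Γ * D ^ 2 - Γ / s * (s * D - 2 * (k * A * p)) ^ 2 := by
        rw [hA]; field_simp; ring
      _ ≤ s * Γ * D ^ 2 := by
        have : 0 ≤ Γ / s * (s * D - 2 * (k * A * p)) ^ 2 := by positivity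
        linarith
  · have hwt : c₁ + Γ * (D - logWeight lam k / s) ≤ 2 * Γ * D := by
      have h5 : -c₃ ≤ logWeight lam k := by
        have := hc₃ k
        have : (0 : ℝ) ≤ k := k.cast_nonneg
        linarith
      have h6 : -c₃ / s ≤ logWeight lam k / s := by gcongr
      have h7 : Γ * (-(logWeight lam k / s)) ≤ Γ * (c₃ / s) := by
        refine mul_le_mul_of_nonneg_left ?_ hΓ.le
        rw [neg_div] at h6
        linarith
      have h8 : Γ * c₃ / s = Γ * (c₃ / s) := by ring
      nlinarith
    calc k * (c₁ + Γ * (D - logWeight lam k / s)) * (4 * p ^ 4 * Real.log D)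
        ≤ k * (2 * Γ * D) * (4 * p ^ 4 * Real.log D) := by gcongr
      _ ≤ D ^ p * (2 * Γ * D) * (4 * p ^ 4 * (s / (8 * p ^ 4) * D ^ (1 - p))) := by gcongr
      _ = s * Γ * D * (D ^ p * D ^ (1 - p)) := by field_simp; ring
      _ = s * Γ * D ^ 2 := by
        rw [← Real.rpow_add hD0, show p + (1 - p) = 1 by ring, Real.rpow_one]
        ring

/-- The number of codebooks is negligible. -/
theorem eventually_log_count_le {s Γ c p : ℝ} (hs : 0 < s) (hΓ : 0 < Γ) (hc : 0 ≤ c)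
    (hp0 : 0 < p) (hp1 : p < 1) :
    ∀ᶠ D : ℝ in atTop, Real.log (s * D + c) + s * Γ * D ^ 2 / (4 * p ^ 4 * Real.log D) ≤
      s * Γ * D ^ 2 / (4 * p ^ 5 * Real.log D) := by
  have hp' : 0 < 1 / p - 1 := by rw [sub_pos, lt_div_iff₀ hp0]; linarith
  have hlit := (isLittleO_log_rpow_atTop (r := 1) one_pos).bound
    (show 0 < (1 / p - 1) * (s * Γ / (4 * p ^ 4)) / (s + c) by positivity)
  filter_upwards [hlit, eventually_gt_atTop 1] with D h1 hD1
  have hD0 : 0 < D := by linarith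
  have hlD : 0 < Real.log D := Real.log_pos hD1
  rw [Real.norm_of_nonneg hlD.le, Real.rpow_one, Real.norm_of_nonneg hD0.le] at h1
  -- A linear bound suffices: the slack between `p^4` and `p^5` is of order `D² / log D`.
  have h2 : Real.log (s * D + c) ≤ (s + c) * D := by
    have := Real.log_le_sub_one_of_pos (show 0 < s * D + c by positivity)
    nlinarith
  have h3 : (s + c) * D ≤ (1 / p - 1) * (s * Γ * D ^ 2 / (4 * p ^ 4 * Real.log D)) := by
    rw [← mul_div_assoc, le_div_iff₀ (by positivity)]
    calc (s + c) * D * (4 * p ^ 4 * Real.log D)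
        ≤ (s + c) * D * (4 * p ^ 4 * ((1 / p - 1) * (s * Γ / (4 * p ^ 4)) / (s + c) * D)) := by
          gcongr
      _ = _ := by field_simp
  have h4 : s * Γ * D ^ 2 / (4 * p ^ 5 * Real.log D) =
      1 / p * (s * Γ * D ^ 2 / (4 * p ^ 4 * Real.log D)) := by field_simp
  rw [h4]
  linarith

end RateAllocation

/-! ### Quantization of jump processes -/

section Quantization

variable {Ω Ω' E : Type*} [MeasurableSpace Ω] [MeasurableSpace Ω'] [NormedAddCommGroup E]
  {P : Measure Ω} {X : Ω → StepPath E} {P' : Measure Ω'} {ζ : Ω' → E} {K lam s : ℝ}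

theorem quantError_anti {S : Type*} {Y : Ω → S} {ρ : S → S → ℝ≥0∞} {r r' : ℝ} (h : r ≤ r') :
    quantError r' P Y ρ s ≤ quantError r P Y ρ s :=
  le_iInf fun C => le_iInf fun h1 => le_iInf fun h2 =>
    iInf_le_of_le C (iInf_le_of_le h1 (iInf_le_of_le (h2.trans h) le_rfl))

theorem one_le_quantNumber {S : Type*} {Y : Ω → S} {ρ : S → S → ℝ≥0∞} (ε : ℝ) :
    1 ≤ quantNumber ε P Y ρ s :=
  le_iInf fun n => le_iInf fun h1 => le_iInf fun _ => by exact_mod_cast h1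

/-- The constant path in `x₀`. -/
def constPath (x₀ : E) : StepPath E := codePath x₀ (fun _ : Fin 0 => 0) (fun _ => 0)

/-- The limsup controls only small `ε`; monotonicity extends the bound to `]0, 1]` at the price of
the additive constant `log d(ε₁)`. -/
theorem exists_log_quantNumber_le {γ g : ℝ}
    (hγ : limsup (fun ε : ℝ => ENNReal.log ((quantNumber ε P' ζ normDist s : ℕ∞) : ℝ≥0∞) /
      ((Real.log (1 / ε) : ℝ) : EReal)) (𝓝[>] 0) = (γ : EReal)) (hg : γ < g) (hg0 : 0 ≤ g) :
    (∀ ε, 0 < ε → quantNumber ε P' ζ normDist s < ⊤) ∧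
    ∃ c, ∀ ε, 0 < ε → ε ≤ 1 → Real.log (quantNumber ε P' ζ normDist s).toNat ≤
      c + g * Real.log (1 / ε) := by
  have hev := eventually_lt_of_limsup_lt (hγ.trans_lt (EReal.coe_lt_coe_iff.2 hg))
  obtain ⟨ε₀, hε₀, hsub⟩ := mem_nhdsGT_iff_exists_Ioo_subset.1 hev
  have hε₀' : (0 : ℝ) < ε₀ := hε₀
  have hsmall : ∀ ε, 0 < ε → ε < min ε₀ 1 → quantNumber ε P' ζ normDist s < ⊤ ∧
      Real.log (quantNumber ε P' ζ normDist s).toNat ≤ g * Real.log (1 / ε) := by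
    intro ε h0 h1
    have hlog : 0 < Real.log (1 / ε) :=
      Real.log_pos (by rw [lt_div_iff₀ h0, one_mul]; exact h1.trans_le (min_le_right _ _))
    have h2 : ENNReal.log ((quantNumber ε P' ζ normDist s : ℕ∞) : ℝ≥0∞) /
      ((Real.log (1 / ε) : ℝ) : EReal) < g := hsub ⟨h0, h1.trans_le (min_le_left _ _)⟩
    rw [EReal.div_lt_iff (EReal.coe_pos.2 hlog) (EReal.coe_ne_top _), ← EReal.coe_mul] at h2
    have hone := one_le_quantNumber (P := P') (Y := ζ) (ρ := normDist) (s := s) ε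
    have hlt : quantNumber ε P' ζ normDist s < ⊤ := by
      refine lt_top_iff_ne_top.2 fun h => ?_
      rw [h] at h2
      simp at h2
    refine ⟨hlt, ?_⟩
    obtain ⟨n, hn⟩ := ENat.ne_top_iff_exists.1 hlt.ne
    rw [← hn] at h2 hone ⊢
    have hn1 : 1 ≤ n := by exact_mod_cast hone
    rw [ENat.toENNReal_coe, ← ENNReal.ofReal_natCast,
      ENNReal.log_ofReal_of_pos (by exact_mod_cast hn1)] at h2
    rw [ENat.toNat_natCast]
    exact (EReal.coe_lt_coe_iff.1 h2).le
  have hmin : 0 < min ε₀ 1 := lt_min hε₀' one_pos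
  set ε₁ := min ε₀ 1 / 2 with hε₁
  have h1 := hsmall ε₁ (by positivity) (by linarith)
  refine ⟨fun ε hε => ?_, Real.log (quantNumber ε₁ P' ζ normDist s).toNat, fun ε h0 hε1 => ?_⟩
  · rcases lt_or_ge ε (min ε₀ 1) with h | h
    · exact (hsmall ε hε h).1
    · exact (quantNumber_anti (by linarith)).trans_lt h1.1
  · rcases lt_or_ge ε (min ε₀ 1) with h | h
    · have := (hsmall ε h0 h).2
      have := Real.log_natCast_nonneg (quantNumber ε₁ P' ζ normDist s).toNat
      linarith
    · have hle : quantNumber ε P' ζ normDist s ≤ quantNumber ε₁ P' ζ normDist s :=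
        quantNumber_anti (by linarith)
      have h2 := ENat.toNat_le_toNat hle h1.1.ne
      have h3 : 0 < (quantNumber ε P' ζ normDist s).toNat := by
        have hone := one_le_quantNumber (P := P') (Y := ζ) (ρ := normDist) (s := s) ε
        have := ENat.toNat_le_toNat hone (hle.trans_lt h1.1).ne
        exact Nat.lt_of_lt_of_le Nat.one_pos (by simpa using this)
      have h4 : Real.log (quantNumber ε P' ζ normDist s).toNat ≤
          Real.log (quantNumber ε₁ P' ζ normDist s).toNat :=
        Real.log_le_log (by exact_mod_cast h3) (by exact_mod_cast h2)
      have h5 : 0 ≤ Real.log (1 / ε) := Real.log_nonneg (by rw [le_div_iff₀ h0]; linarith)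
      nlinarith [mul_nonneg hg0 h5]

theorem nonneg_of_limsup_eq {γ : ℝ}
    (hγ : limsup (fun ε : ℝ => ENNReal.log ((quantNumber ε P' ζ normDist s : ℕ∞) : ℝ≥0∞) /
      ((Real.log (1 / ε) : ℝ) : EReal)) (𝓝[>] 0) = (γ : EReal)) : 0 ≤ γ := by
  rw [← EReal.coe_nonneg, ← hγ]
  refine le_limsup_of_frequently_le' (Eventually.frequently ?_)
  filter_upwards [Ioo_mem_nhdsGT (show (0 : ℝ) < 1 from one_pos)] with ε hε
  refine EReal.div_nonneg ?_ (EReal.coe_nonneg.2 (Real.log_nonneg ?_))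
  · rw [ENNReal.zero_le_log_iff]
    exact_mod_cast one_le_quantNumber (P := P') (Y := ζ) (ρ := normDist) (s := s) ε
  · rw [le_div_iff₀ hε.1]
    linarith [hε.2]

variable [MeasurableSpace E] [MeasurableSub₂ E]

/-- A codebook for the paths with `k` jumps, at accuracy `e ^ (-u)`. -/
theorem IsJumpModel.exists_codebook_numJumps [IsProbabilityMeasure P] [IsProbabilityMeasure P']
    (hM : IsJumpModel P X P' ζ K lam) (hn : Measurable (fun x : E => ‖x‖)) (hs : 0 < s) {x₀ : E}
    (h0 : ∀ᵐ ω ∂P, (X ω).1 ⟨0, by norm_num⟩ = x₀) {c g : ℝ}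
    (hfin : ∀ ε, 0 < ε → quantNumber ε P' ζ normDist s < ⊤)
    (hlog : ∀ ε, 0 < ε → ε ≤ 1 → Real.log (quantNumber ε P' ζ normDist s).toNat ≤
      c + g * Real.log (1 / ε)) (k : ℕ) (u : ℝ) :
    ∃ (C : Finset (StepPath E)) (G : Ω → StepPath E), (∀ ω, G ω ∈ C) ∧
      (0 ≤ u → (C.card : ℝ) ≤ Real.exp (k * (c + (1 + g) * u))) ∧ (u < 0 → C = {constPath x₀}) ∧
      ∫⁻ ω in {ω | numJumps (X ω) = k}, pathDist normDist (X ω) (G ω) ^ s ∂P ≤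
        (2 * k : ℝ≥0∞) ^ s * k * P {ω | numJumps (X ω) = k} *
          (ENNReal.ofReal (Real.exp (-u)) ^ s *
            ((2 + 2 ^ s) * (1 + ∫⁻ ω, ‖ζ ω‖ₑ ^ s ∂P'))) := by
  classical
  set M := ∫⁻ ω, ‖ζ ω‖ₑ ^ s ∂P' with hMdef
  rcases le_or_gt 0 u with hu | hu
  · obtain ⟨m, hm0, hm1, hm2⟩ := exists_grid_size hu
    obtain ⟨n, a, idx, hn1, hnd, hidx, hq⟩ :=
      exists_codebook hn hs (Real.exp_pos (-u)) (hfin _ (Real.exp_pos (-u)))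
    have : NeZero m := ⟨hm0⟩
    refine ⟨Finset.univ.image (fun e : Fin k → Fin m × Fin n => decodePath x₀ a e),
      fun ω => decodePath x₀ a (encodePath idx k (X ω)),
      fun ω => Finset.mem_image_of_mem _ (Finset.mem_univ _), fun _ => ?_,
      fun h => absurd h (not_lt.2 hu), ?_⟩
    · have hcard : ((Finset.univ.image
          (fun e : Fin k → Fin m × Fin n => decodePath x₀ a e)).card : ℝ) ≤ (m * n : ℝ) ^ k := by
        have := Finset.card_image_le (s := Finset.univ)
          (f := fun e : Fin k → Fin m × Fin n => decodePath x₀ a e)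
        rw [Finset.card_univ, Fintype.card_fun, Fintype.card_prod, Fintype.card_fin,
          Fintype.card_fin, Fintype.card_fin] at this
        exact_mod_cast this
      have hm' : (0 : ℝ) < m := by exact_mod_cast Nat.pos_of_ne_zero hm0
      have hn' : (0 : ℝ) < n := by exact_mod_cast hn1
      have hl := hlog (Real.exp (-u)) (Real.exp_pos _) (Real.exp_le_one_iff.2 (by linarith))
      rw [one_div, ← Real.exp_neg, neg_neg, Real.log_exp] at hl
      have hln : Real.log n ≤ c + g * u :=
        (Real.log_le_log hn' (by exact_mod_cast hnd)).trans hl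
      refine hcard.trans ?_
      rw [← Real.log_le_iff_le_exp (by positivity), Real.log_pow, Real.log_mul hm'.ne' hn'.ne']
      refine mul_le_mul_of_nonneg_left ?_ k.cast_nonneg
      linarith
    · refine (hM.setLIntegral_pathDist_le hn hs h0 k a hidx).trans ?_
      gcongr
      calc _ ≤ ENNReal.ofReal (2 * Real.exp (-u)) ^ s +
            ENNReal.ofReal (2 * Real.exp (-u)) ^ s * M := by gcongr
        _ = ENNReal.ofReal (Real.exp (-u)) ^ s * (2 ^ s * (1 + M)) := by
          rw [ENNReal.ofReal_mul (by positivity), ENNReal.mul_rpow_of_nonneg _ _ hs.le,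
            ENNReal.ofReal_ofNat]
          ring
        _ ≤ _ := by
          gcongr
          exact le_add_self
  · refine ⟨{constPath x₀}, fun _ => constPath x₀, fun _ => Finset.mem_singleton_self _,
      fun h => absurd hu (not_lt.2 h), fun _ => rfl, ?_⟩
    -- With one grid point and the single code increment `0`, the general estimate bounds the error
    -- of the constant path; this is enough because `e^{-u} ≥ 1`.
    have h := hM.setLIntegral_pathDist_le hn hs h0 k (m := 1) (n := 1) (fun _ => 0)
      (idx := fun _ => 0) measurable_const
    have hconst : ∀ ω, decodePath x₀ (fun _ => 0)
        (encodePath (m := 1) (n := 1) (fun _ => 0) k (X ω)) = constPath x₀ :=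
      fun ω => codePath_zero x₀ _ _
    simp_rw [hconst] at h
    refine h.trans ?_
    gcongr
    simp only [sub_zero, Nat.cast_one, inv_one, ENNReal.ofReal_one, ENNReal.one_rpow, one_mul]
    rw [← hMdef]
    have h1 : 1 ≤ ENNReal.ofReal (Real.exp (-u)) ^ s := by
      refine ENNReal.one_le_rpow ?_ hs
      rw [ENNReal.one_le_ofReal]
      exact Real.one_le_exp (by linarith)
    calc M + M = 1 * (2 * M) := by ring
      _ ≤ _ := by
        gcongr
        · exact le_self_add
        · exact le_add_self

/-- The constant of the quantization bound, before taking the `s`-th root. -/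
def quantConst (s K lam : ℝ) (M : ℝ≥0∞) : ℝ≥0∞ :=
  (∑' k : ℕ, (2 * k : ℝ≥0∞) ^ s * k * ENNReal.ofReal ((1 / 2) ^ k)) *
    (ENNReal.ofReal (Real.exp (-lam) * K) * ((2 + 2 ^ s) * (1 + M)))

/-- The reason for `logWeight`: it cancels `lam^k / k!`, and its factor `2^k` leaves `2^{-k}` to
make the polynomial factors in `k` summable. -/
theorem poissonBound_mul_exp {D : ℝ} (hs : 0 < s) (hlam : 0 < lam) (k : ℕ) :
    poissonBound K lam k * Real.exp (-(D - logWeight lam k / s)) ^ s =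
      Real.exp (-D) ^ s * ((1 / 2) ^ k * (Real.exp (-lam) * K)) := by
  have hfac : (0 : ℝ) < k.factorial := by exact_mod_cast k.factorial_pos
  have h1 : Real.exp (-(D - logWeight lam k / s)) ^ s =
      Real.exp (-D) ^ s * (k.factorial / (2 * lam) ^ k) := by
    rw [← Real.exp_mul, ← Real.exp_mul, ← Real.exp_log (show 0 < k.factorial / (2 * lam) ^ k by
      positivity), ← Real.exp_add, logWeight]
    congr 1
    field_simp
    ring
  rw [h1, poissonBound, mul_pow, one_div, inv_pow]
  field_simp

theorem IsJumpModel.quantError_le [IsProbabilityMeasure P] [IsProbabilityMeasure P']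
    (hM : IsJumpModel P X P' ζ K lam) (hn : Measurable (fun x : E => ‖x‖)) (hs : 0 < s) {c g : ℝ}
    (hfin : ∀ ε, 0 < ε → quantNumber ε P' ζ normDist s < ⊤)
    (hlog : ∀ ε, 0 < ε → ε ≤ 1 → Real.log (quantNumber ε P' ζ normDist s).toNat ≤
      c + g * Real.log (1 / ε)) {D M₀ : ℝ} {L : ℕ} (hM₀ : 0 ≤ M₀)
    (hL : ∀ k, L ≤ k → D - logWeight lam k / s < 0)
    (hrate : ∀ k : ℕ, k * (c + (1 + g) * (D - logWeight lam k / s)) ≤ M₀) :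
    quantError (Real.log (1 + L) + M₀) P X (pathDist normDist) s ≤
      ENNReal.ofReal (Real.exp (-D)) * quantConst s K lam (∫⁻ ω, ‖ζ ω‖ₑ ^ s ∂P') ^ (1 / s) := by
  classical
  obtain ⟨x₀, h0⟩ := hM.start
  set M := ∫⁻ ω, ‖ζ ω‖ₑ ^ s ∂P'
  set u : ℕ → ℝ := fun k => D - logWeight lam k / s with hu
  choose C G hGC hcard hsing herr using fun k =>
    hM.exists_codebook_numJumps hn hs h0 hfin hlog k (u k)
  -- The constant path serves every `k` with `u k < 0`, in particular all `k ≥ L`; at most `L`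
  -- codebooks of size at most `e^{M₀}` remain.
  set B : Finset (StepPath E) :=
    insert (constPath x₀) (((Finset.range L).filter fun k => 0 ≤ u k).biUnion C) with hB
  have hmem : ∀ k ω, G k ω ∈ B := by
    intro k ω
    rcases le_or_gt 0 (u k) with h | h
    · refine Finset.mem_insert_of_mem (Finset.mem_biUnion.2 ⟨k, Finset.mem_filter.2
        ⟨Finset.mem_range.2 ?_, h⟩, hGC k ω⟩)
      by_contra hc
      exact absurd (hL k (not_lt.1 hc)) (not_lt.2 h)
    · have h1 := hGC k ω
      rw [hsing k h, Finset.mem_singleton] at h1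
      rw [h1]
      exact Finset.mem_insert_self _ _
  have hBne : B.Nonempty := ⟨_, Finset.mem_insert_self _ _⟩
  have hBcard : (B.card : ℝ) ≤ (1 + L) * Real.exp M₀ := by
    have h1 : (B.card : ℝ) ≤ (∑ k ∈ (Finset.range L).filter fun k => 0 ≤ u k, ((C k).card : ℝ)) + 1 := by
      exact_mod_cast (Finset.card_insert_le _ _).trans (Nat.add_le_add_right Finset.card_biUnion_le 1)
    have h2 : (∑ k ∈ (Finset.range L).filter fun k => 0 ≤ u k, ((C k).card : ℝ)) ≤
        ((Finset.range L).filter fun k => 0 ≤ u k).card • Real.exp M₀ :=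
      Finset.sum_le_card_nsmul _ _ _ fun k hk =>
        (hcard k (Finset.mem_filter.1 hk).2).trans (Real.exp_le_exp.2 (hrate k))
    have h3 : (((Finset.range L).filter fun k => 0 ≤ u k).card : ℝ) ≤ L := by
      exact_mod_cast (Finset.card_filter_le _ _).trans_eq (Finset.card_range L)
    have h4 := Real.one_le_exp hM₀
    rw [nsmul_eq_mul] at h2
    nlinarith
  have hlogB : Real.log B.card ≤ Real.log (1 + L) + M₀ := by
    have hpos : (0 : ℝ) < B.card := by exact_mod_cast hBne.card_pos
    refine (Real.log_le_log hpos hBcard).trans_eq ?_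
    rw [Real.log_mul (by positivity) (Real.exp_pos _).ne', Real.log_exp]
  refine iInf_le_of_le B (iInf_le_of_le hBne (iInf_le_of_le hlogB ?_))
  have key : ∫⁻ ω, ⨅ a ∈ B, pathDist normDist (X ω) a ^ s ∂P ≤
      ENNReal.ofReal (Real.exp (-D)) ^ s * quantConst s K lam M := by
    refine (lintegral_le_tsum_numJumps (X := X) _).trans ?_
    rw [quantConst, mul_left_comm, ← ENNReal.tsum_mul_right]
    refine ENNReal.tsum_le_tsum fun k => ?_
    calc ∫⁻ ω in {ω | numJumps (X ω) = k}, ⨅ a ∈ B, pathDist normDist (X ω) a ^ s ∂P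
        ≤ ∫⁻ ω in {ω | numJumps (X ω) = k}, pathDist normDist (X ω) (G k ω) ^ s ∂P :=
          lintegral_mono fun ω => iInf₂_le _ (hmem k ω)
      _ ≤ _ := herr k
      _ ≤ (2 * k : ℝ≥0∞) ^ s * k * ENNReal.ofReal (poissonBound K lam k) *
          (ENNReal.ofReal (Real.exp (-u k)) ^ s * ((2 + 2 ^ s) * (1 + M))) := by
          gcongr
          exact hM.measure_numJumps_le k
      _ = (2 * k : ℝ≥0∞) ^ s * k * (ENNReal.ofReal (poissonBound K lam k *
          Real.exp (-u k) ^ s) * ((2 + 2 ^ s) * (1 + M))) := by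
          rw [ENNReal.ofReal_mul (hM.poissonBound_nonneg k),
            ← ENNReal.ofReal_rpow_of_pos (Real.exp_pos _)]
          ring
      _ = _ := by
          rw [hu, poissonBound_mul_exp hs hM.lam_pos,
            ENNReal.ofReal_mul (p := Real.exp (-D) ^ s) (by positivity),
            ENNReal.ofReal_mul (p := (1 / 2) ^ k) (by positivity),
            ← ENNReal.ofReal_rpow_of_pos (Real.exp_pos _)]
          ring
  refine (ENNReal.rpow_le_rpow key (by positivity)).trans_eq ?_
  rw [ENNReal.mul_rpow_of_nonneg _ _ (by positivity), ← ENNReal.rpow_mul,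
    mul_one_div_cancel hs.ne', ENNReal.rpow_one]

/-- The quantization error at the rate `s (1 + g) D² / (4 log D)`, up to a factor of the rate. -/
theorem IsJumpModel.eventually_quantError_le [IsProbabilityMeasure P] [IsProbabilityMeasure P']
    (hM : IsJumpModel P X P' ζ K lam) (hn : Measurable (fun x : E => ‖x‖)) (hs : 0 < s) {c g p : ℝ}
    (hg : 0 < 1 + g) (hp0 : 0 < p) (hp1 : p < 1)
    (hfin : ∀ ε, 0 < ε → quantNumber ε P' ζ normDist s < ⊤)
    (hlog : ∀ ε, 0 < ε → ε ≤ 1 → Real.log (quantNumber ε P' ζ normDist s).toNat ≤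
      c + g * Real.log (1 / ε)) :
    ∃ b : ℝ, ∀ᶠ D : ℝ in atTop,
      quantError (s * (1 + g) * D ^ 2 / (4 * p ^ 5 * Real.log D)) P X (pathDist normDist) s ≤
        ENNReal.ofReal (Real.exp (b - D)) := by
  obtain ⟨c₃, hc₃0, hc₃⟩ := exists_sub_le_logWeight hM.lam_pos
  have hMtop := moment_lt_top hn hs one_pos (hfin 1 one_pos)
  have hBtop : quantConst s K lam (∫⁻ ω, ‖ζ ω‖ₑ ^ s ∂P') ^ (1 / s) ≠ ⊤ := by
    refine ENNReal.rpow_ne_top_of_nonneg (by positivity) (ENNReal.mul_lt_top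
      (tsum_geometric_moment_lt_top s) (ENNReal.mul_lt_top ENNReal.ofReal_lt_top
        (ENNReal.mul_lt_top ?_ (ENNReal.add_lt_top.2 ⟨ENNReal.one_lt_top, hMtop⟩)))).ne
    exact ENNReal.add_lt_top.2 ⟨by simp, ENNReal.rpow_lt_top_of_nonneg hs.le (by simp)⟩
  set B := quantConst s K lam (∫⁻ ω, ‖ζ ω‖ₑ ^ s ∂P') ^ (1 / s)
  -- The multiplicative constant becomes the additive shift `b` of `D`, which is harmless as `D →
  -- ∞`.
  have hB : B ≤ ENNReal.ofReal (Real.exp B.toReal) := by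
    refine (ENNReal.le_ofReal_iff_toReal_le hBtop (Real.exp_pos _).le).2 ?_
    linarith [Real.add_one_le_exp B.toReal]
  refine ⟨B.toReal, ?_⟩
  filter_upwards [eventually_rate_le hM.lam_pos (c₁ := c) hs hg hp0 hp1,
    eventually_log_count_le hs hg (show 0 ≤ c₃ + 3 by positivity) hp0 hp1, eventually_gt_atTop 1]
    with D h1 h2 hD
  have hlD := Real.log_pos hD
  have hlt : s * D + c₃ < ⌊s * D + c₃⌋₊ + 1 := Nat.lt_floor_add_one _
  have hle : (⌊s * D + c₃⌋₊ : ℝ) ≤ s * D + c₃ := Nat.floor_le (by positivity)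
  have h3 := hM.quantError_le hn hs hfin hlog (D := D) (L := ⌊s * D + c₃⌋₊ + 1)
    (M₀ := s * (1 + g) * D ^ 2 / (4 * p ^ 4 * Real.log D)) (by positivity) (fun k hk => ?_) h1
  · refine (quantError_anti ?_).trans (h3.trans ?_)
    · refine le_trans (add_le_add (Real.log_le_log (by positivity) ?_) le_rfl) h2
      push_cast
      linarith
    · rw [sub_eq_neg_add, Real.exp_add, ENNReal.ofReal_mul (Real.exp_pos _).le]
      gcongr
  · have hk' : (⌊s * D + c₃⌋₊ : ℝ) + 1 ≤ k := by exact_mod_cast hk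
    have := hc₃ k
    rw [sub_neg, lt_div_iff₀ hs]
    linarith

/-- From `quantError` bounds along `D` to the asymptotics in the rate. -/
theorem asympGE_of_eventually_le {q : ℝ → ℝ≥0∞} (hq : Antitone q) {s Γ : ℝ} (hs : 0 < s)
    (hΓ : 0 < Γ)
    (h : ∀ p : ℝ, 0 < p → p < 1 → ∃ b : ℝ, ∀ᶠ D : ℝ in atTop,
      q (s * (Γ / p) * D ^ 2 / (4 * p ^ 5 * Real.log D)) ≤ ENNReal.ofReal (Real.exp (b - D))) :
    AsympGE (fun r => -ENNReal.log (q r)) (fun r => √(2 / (s * Γ) * (r * Real.log r))) := by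
  have hlim : ∀ p : ℝ, 0 < p → p < 1 → ((p ^ 5 : ℝ) : EReal) ≤
      liminf (fun r => -ENNReal.log (q r) / ((√(2 / (s * Γ) * (r * Real.log r)) : ℝ) : EReal))
        atTop := by
    intro p hp0 hp1
    obtain ⟨b, hb⟩ := h p hp0 hp1
    set G : ℝ → ℝ := fun r => √(2 / (s * Γ) * (r * Real.log r)) with hG
    have hGtop : Tendsto G atTop atTop :=
      Real.tendsto_sqrt_atTop.comp
        ((tendsto_id.atTop_mul_atTop₀ Real.tendsto_log_atTop).const_mul_atTop (by positivity))
    -- The choice `D = p^4 G(r)` costs a rate of at most `r`, and going down to `p^5 G(r)` leaves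
    -- room for `b`.
    have hDtop : Tendsto (fun r => p ^ 4 * G r) atTop atTop := hGtop.const_mul_atTop (by positivity)
    refine le_liminf_of_le (by isBoundedDefault) ?_
    filter_upwards [hDtop.eventually hb, eventually_gt_atTop 1, hDtop.eventually_gt_atTop 1,
      Real.tendsto_log_atTop.eventually_ge_atTop (s * Γ / (2 * p ^ 8)),
      hGtop.eventually_ge_atTop (b / (p ^ 4 - p ^ 5))] with r h1 hr hD h2 h3
    have hlr := Real.log_pos hr
    have hlD := Real.log_pos hD
    have hG2 : G r ^ 2 = 2 / (s * Γ) * (r * Real.log r) := Real.sq_sqrt (by positivity)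
    have hG0 : 0 < G r := Real.sqrt_pos.2 (by positivity)
    have hp45 : 0 < p ^ 4 - p ^ 5 := by
      have : p ^ 4 - p ^ 5 = p ^ 4 * (1 - p) := by ring
      rw [this]
      exact mul_pos (by positivity) (by linarith)
    -- `D²` is `r` times a multiple of `log r` that eventually exceeds `1`; this is where `4 log D`
    -- turns into `2 log r`.
    have hhalf : Real.log r ≤ 2 * Real.log (p ^ 4 * G r) := by
      rw [← Nat.cast_ofNat, ← Real.log_pow]
      refine Real.log_le_log (by linarith) ?_
      rw [mul_pow, hG2]
      rw [div_le_iff₀ (by positivity)] at h2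
      have : (p ^ 4) ^ 2 * (2 / (s * Γ) * (r * Real.log r)) =
          r * (Real.log r * (2 * p ^ 8) / (s * Γ)) := by field_simp
      rw [this]
      refine le_mul_of_one_le_right (by linarith) ?_
      rwa [le_div_iff₀ (by positivity), one_mul]
    have hrate : s * (Γ / p) * (p ^ 4 * G r) ^ 2 / (4 * p ^ 5 * Real.log (p ^ 4 * G r)) ≤ r := by
      rw [div_le_iff₀ (by positivity), mul_pow, hG2]
      have e1 : s * (Γ / p) * ((p ^ 4) ^ 2 * (2 / (s * Γ) * (r * Real.log r))) =
          p ^ 5 * r * (p ^ 2 * (2 * Real.log r)) := by field_simp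
      rw [e1]
      have hp2 : p ^ 2 ≤ 1 := pow_le_one₀ hp0.le hp1.le
      calc p ^ 5 * r * (p ^ 2 * (2 * Real.log r))
          ≤ p ^ 5 * r * (1 * (2 * (2 * Real.log (p ^ 4 * G r)))) := by gcongr
        _ = _ := by ring
    have h4 : ENNReal.log (q r) ≤ ((b - p ^ 4 * G r : ℝ) : EReal) := by
      have := ENNReal.log_monotone ((hq hrate).trans h1)
      rwa [ENNReal.log_ofReal_of_pos (Real.exp_pos _), Real.log_exp] at this
    rw [EReal.le_div_iff_mul_le (EReal.coe_pos.2 hG0) (EReal.coe_ne_top _),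
      EReal.le_neg, ← EReal.coe_mul]
    refine h4.trans ?_
    rw [← EReal.coe_neg, EReal.coe_le_coe_iff]
    rw [div_le_iff₀ hp45] at h3
    linarith
  have htend : Tendsto (fun p : ℝ => ((p ^ 5 : ℝ) : EReal)) (𝓝[<] 1) (𝓝 1) := by
    have : Tendsto (fun p : ℝ => p ^ 5) (𝓝[<] 1) (𝓝 1) := by
      have h1 : ContinuousAt (fun p : ℝ => p ^ 5) 1 := by fun_prop
      have h2 := h1.tendsto.mono_left (nhdsWithin_le_nhds (s := Set.Iio 1))
      simpa using h2
    exact (continuous_coe_real_ereal.tendsto 1).comp this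
  refine le_of_tendsto htend ?_
  filter_upwards [Ioo_mem_nhdsLT (show (0 : ℝ) < 1 from one_pos)] with p hp
  exact hlim p hp.1 hp.2

end Quantization

end

theorem mainTheorem6 :
    ∃ C : ℝ → ℝ → ℝ → ℝ≥0∞ → ℝ, (∀ s K lam m, 0 < C s K lam m) ∧
      ∀ (E : Type*) [NormedAddCommGroup E] [NormedSpace ℝ E] [MeasurableSpace E]
        [MeasurableSub₂ E] (_ : Measurable (fun x : E => ‖x‖))
        (Ω : Type*) [MeasurableSpace Ω] (P : Measure Ω) [IsProbabilityMeasure P]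
        (Ω' : Type*) [MeasurableSpace Ω'] (P' : Measure Ω') [IsProbabilityMeasure P']
        (X : Ω → StepPath E) (ζ : Ω' → E) (s K lam : ℝ) (_ : 0 < s)
        (_ : IsJumpModel P X P' ζ K lam),
        (∀ γ : ℝ,
          limsup (fun ε : ℝ =>
            ENNReal.log ((quantNumber ε P' ζ normDist s : ℕ∞) : ℝ≥0∞) /
              ((Real.log (1 / ε) : ℝ) : EReal)) (𝓝[>] 0) = (γ : EReal) →
          AsympGE (fun r => -ENNReal.log (quantError r P X (pathDist normDist) s))
            (fun r => √(2 / (s * (1 + γ)) * (r * Real.log r)))) ∧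
        ((∀ ε : ℝ, 0 < ε → quantNumber ε P' ζ normDist s < ⊤) →
          ∀ r : ℝ, 0 ≤ r →
            entropyError
              (K * (lam * r +
                lam * Real.log ((quantNumber (Real.exp (-r)) P' ζ normDist s).toNat : ℝ)))
              P X (pathDist normDist) s ≤
            ENNReal.ofReal (C s K lam (∫⁻ ω, ‖ζ ω‖ₑ ^ s ∂P') * Real.exp (-r))) := by
  refine ⟨fun s K lam m => (entropyConst s K lam m ^ (1 / s)).toReal + 1, fun s K lam m => ?_, ?_⟩
  · exact add_pos_of_nonneg_of_pos ENNReal.toReal_nonneg one_pos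
  intro E _ _ _ _ hn Ω _ P _ Ω' _ P' _ X ζ s K lam hs hM
  refine ⟨fun γ hγ => ?_, fun hfin r hr =>
    hM.entropyError_le hn hs hr (hfin _ (Real.exp_pos _))⟩
  have hγ0 := nonneg_of_limsup_eq hγ
  refine asympGE_of_eventually_le (fun r r' h => quantError_anti h) hs (by linarith)
    fun p hp0 hp1 => ?_
  -- This `g` satisfies `1 + g = (1 + γ) / p`, so the strict inequality `γ < g` costs only a factor
  -- that tends to `1` with `p`.
  have hg : γ < (1 + γ) / p - 1 := by
    rw [lt_sub_iff_add_lt, lt_div_iff₀ hp0]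
    nlinarith
  obtain ⟨hfin, c, hc⟩ := exists_log_quantNumber_le hγ hg (by linarith)
  have h := hM.eventually_quantError_le hn hs (by linarith) hp0 hp1 hfin hc
  rwa [add_sub_cancel] at h
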